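/- Let $V$ (state space) and $W$ (data space) be separable real Hilbert spaces, each of finite or infinite dimension. For $u,v\in V$ let $u\otimes v$ denote the operator $w\mapsto u\langle v,w\rangle$, and let $|\cdot|$ denote the norm of $V$, of $W$, or the operator norm. For each time $k\ge 1$ let $M^{(k)}:V\to V$ and $H^{(k)}:V\to W$ be bounded linear operators, $b^{(k)}\in V$, $d^{(k)}\in W$, and let $R^{(k)}$ be a bounded operator on $W$ with $R^{(k)}>0$, that is, symmetric and bounded below ($\langle R^{(k)}w,w\rangle\ge\alpha|w|^2$ for all $w$ and some $\alpha>0$). Put $$\mathcal K^{(k)}(Q)=QH^{(k)*}\bigl(H^{(k)}QH^{(k)*}+R^{(k)}\bigr)^{-1},\quad \mathcal B^{(k)}(x,Q)=x+\mathcal K^{(k)}(Q)(d^{(k)}-H^{(k)}x),\quad \mathcal A^{(k)}(Q)=Q-\mathcal K^{(k)}(Q)H^{(k)}Q .$$ Let $\mu_0$ be a probability distribution on $V$ with all moments finite, $\int|x|^q\,d\mu_0(x)<\infty$ for all $1\le q<\infty$. The \emph{Kalman filter} has the initial analysis mean $\overline X^{(0),a}=E(X)$ and covariance $Q^{(0),a}=E\bigl((X-E(X))\otimes(X-E(X))\bigr)$,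 where $X\sim\mu_0$, and for $k\ge1$ $$\overline X^{(k),f}=M^{(k)}\overline X^{(k-1),a}+b^{(k)},\quad Q^{(k),f}=M^{(k)}Q^{(k-1),a}M^{(k)*},\quad \overline X^{(k),a}=\mathcal B^{(k)}(\overline X^{(k),f},Q^{(k),f}),\quad Q^{(k),a}=\mathcal A^{(k)}(Q^{(k),f}).$$ For an ensemble $\boldsymbol x=(x_1,\dots,x_N)$ in $V$ let $E_N(\boldsymbol x)=\frac1N\sum_i x_i$ and $C_N(\boldsymbol x)=\frac1N\sum_i(x_i-E_N(\boldsymbol x))\otimes(x_i-E_N(\boldsymbol x))$. An \emph{unbiased square root ensemble filter} with $N\ge1$ members consists of ensembles $\boldsymbol X_N^{(k),a}=(X^{(k),a}_1,\dots,X^{(k),a}_N)$, $k\ge0$, of $V$-valued random elements on a probability space such that $X^{(0),a}_1,\dots,X^{(0),a}_N$ are i.i.d. with distribution $\mu_0$ and, for every $k\ge1$, with the forecast ensemble $X_i^{(k),f}=M^{(k)}X_i^{(k-1),a}+b^{(k)}$, almost surely $$E_N(\boldsymbol X_N^{(k),a})=\mathcal B^{(k)}\bigl(E_N(\boldsymbol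 X_N^{(k),f}),C_N(\boldsymbol X_N^{(k),f})\bigr),\qquad C_N(\boldsymbol X_N^{(k),a})=\mathcal A^{(k)}\bigl(C_N(\boldsymbol X_N^{(k),f})\bigr).$$ Then for all $k\ge0$ and $1\le p<\infty$, the ensemble mean and covariance of any unbiased square root ensemble filter converge in $L^p$ to the mean and covariance of the Kalman filter as $N\to\infty$, and for all $N=1,2,\dots$ $$\bigl(E\,|E_N(\boldsymbol X_N^{(k),a})-\overline X^{(k),a}|^p\bigr)^{1/p}\le\frac{C}{\sqrt N},\qquad \bigl(E\,|C_N(\boldsymbol X_N^{(k),a})-Q^{(k),a}|^p\bigr)^{1/p}\le\frac{C}{\sqrt N},$$ where the constant $C$ depends only on $p$, $k$, upper bounds for the norms $|M^{(j)}|,|b^{(j)}|,|H^{(j)}|,|(R^{(j)})^{-1}|,|d^{(j)}|$, $1\le j\le k$, and upper bounds for the moments $\int|x|^q\,d\mu_0(x)$, $1\le q<\infty$; in particular, it depends neither on the spaces $V$, $W$ and their dimensions, nor on the ensemble size $N$, nor on the particular filter. -/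

import Mathlib

open MeasureTheory ProbabilityTheory Filter Topology

noncomputable section

namespace EnsembleFilter

/-- `A > 0` for a bounded operator on a Hilbert space: symmetric and bounded below. -/
def IsPosDef {W : Type*} [NormedAddCommGroup W] [InnerProductSpace ℝ W]
    (A : W →L[ℝ] W) : Prop :=
  (∀ u v : W, inner ℝ (A u) v = inner ℝ u (A v)) ∧
    ∃ α : ℝ, 0 < α ∧ ∀ u : W, α * ‖u‖ ^ 2 ≤ inner ℝ (A u) u

/-- The deterministic inputs of the filtering problem on the state space `V` and the data space
`W`, at times `k = 1, 2, …` (the values at `k = 0` play no role): the affine model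
`x ↦ M k x + b k`, the observation operator `H k`, the data error covariance `R k > 0` and the
data vector `d k`. -/
structure Problem (V W : Type*) [NormedAddCommGroup V] [InnerProductSpace ℝ V]
    [NormedAddCommGroup W] [InnerProductSpace ℝ W] where
  M : ℕ → V →L[ℝ] V
  b : ℕ → V
  H : ℕ → V →L[ℝ] W
  R : ℕ → W →L[ℝ] W
  d : ℕ → W
  R_pos : ∀ k, 1 ≤ k → IsPosDef (R k)

section Analysis

variable {V W : Type*} [NormedAddCommGroup V] [InnerProductSpace ℝ V] [CompleteSpace V]
  [NormedAddCommGroup W] [InnerProductSpace ℝ W] [CompleteSpace W]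

/-- Kalman gain `𝒦(Q) = Q H* (H Q H* + R)⁻¹`. -/
def gain (H : V →L[ℝ] W) (R : W →L[ℝ] W) (Q : V →L[ℝ] V) : W →L[ℝ] V :=
  Q ∘L H.adjoint ∘L Ring.inverse (H ∘L Q ∘L H.adjoint + R)

/-- Analysis mean `ℬ(x, Q) = x + 𝒦(Q) (d - H x)`. -/
def analysisMean (H : V →L[ℝ] W) (R : W →L[ℝ] W) (d : W) (x : V) (Q : V →L[ℝ] V) : V :=
  x + gain H R Q (d - H x)

/-- Analysis covariance `𝒜(Q) = Q - 𝒦(Q) H Q`. -/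
def analysisCov (H : V →L[ℝ] W) (R : W →L[ℝ] W) (Q : V →L[ℝ] V) : V →L[ℝ] V :=
  Q - gain H R Q ∘L H ∘L Q

/-- The Kalman filter started from the mean `m₀` and the covariance `B`: the pair of the analysis
mean and the analysis covariance at time `k`. -/
def kalman (S : Problem V W) (m₀ : V) (B : V →L[ℝ] V) : ℕ → V × (V →L[ℝ] V)
  | 0 => (m₀, B)
  | k + 1 =>
    let xf : V := S.M (k + 1) (kalman S m₀ B k).1 + S.b (k + 1)
    let Qf : V →L[ℝ] V := S.M (k + 1) ∘L (kalman S m₀ B k).2 ∘L (S.M (k + 1)).adjoint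
    (analysisMean (S.H (k + 1)) (S.R (k + 1)) (S.d (k + 1)) xf Qf,
      analysisCov (S.H (k + 1)) (S.R (k + 1)) Qf)

end Analysis

section Ensemble

variable {V : Type*} [NormedAddCommGroup V] [InnerProductSpace ℝ V]

/-- Ensemble mean `(1/N) ∑ xᵢ`. -/
def ensMean {N : ℕ} (x : Fin N → V) : V := (N : ℝ)⁻¹ • ∑ i, x i

/-- Ensemble covariance `(1/N) ∑ (xᵢ - x̄) ⊗ (xᵢ - x̄)`. -/
def ensCov {N : ℕ} (x : Fin N → V) : V →L[ℝ] V :=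
  (N : ℝ)⁻¹ • ∑ i, InnerProductSpace.rankOne ℝ (x i - ensMean x) (x i - ensMean x)

/-- Mean of a distribution on `V`. -/
def distMean [MeasurableSpace V] (μ : Measure V) : V := ∫ x, x ∂μ

/-- Covariance of a distribution on `V`: the expectation of `(x - E x) ⊗ (x - E x)`. -/
def distCov [MeasurableSpace V] (μ : Measure V) : V →L[ℝ] V :=
  ∫ x, InnerProductSpace.rankOne ℝ (x - distMean μ) (x - distMean μ) ∂μ

end Ensemble

/-- `X k i` is the `i`-th member of the analysis ensemble at time `k` of a run, with `N` members,
of an unbiased square root ensemble filter: the initial ensemble is an i.i.d. sample from `μ₀`, and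
the analysis ensemble at each later time is any ensemble of random elements whose ensemble mean and
covariance are obtained from those of the forecast ensemble by the Kalman update. -/
structure IsUnbiasedSqrtFilter {V W Ω : Type*}
    [NormedAddCommGroup V] [InnerProductSpace ℝ V] [CompleteSpace V] [MeasurableSpace V]
    [NormedAddCommGroup W] [InnerProductSpace ℝ W] [CompleteSpace W]
    [MeasurableSpace Ω] (S : Problem V W) (μ₀ : Measure V) (P : Measure Ω) {N : ℕ}
    (X : ℕ → Fin N → Ω → V) : Prop where
  aemeasurable : ∀ k i, AEMeasurable (X k i) P
  indep : iIndepFun (X 0) P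
  law : ∀ i, HasLaw (X 0 i) μ₀ P
  mean : ∀ k, ∀ᵐ ω ∂P,
    let Xf : Fin N → V := fun i => S.M (k + 1) (X k i ω) + S.b (k + 1)
    ensMean (fun i => X (k + 1) i ω) =
      analysisMean (S.H (k + 1)) (S.R (k + 1)) (S.d (k + 1)) (ensMean Xf) (ensCov Xf)
  cov : ∀ k, ∀ᵐ ω ∂P,
    let Xf : Fin N → V := fun i => S.M (k + 1) (X k i ω) + S.b (k + 1)
    ensCov (fun i => X (k + 1) i ω) =
      analysisCov (S.H (k + 1)) (S.R (k + 1)) (ensCov Xf)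

end EnsembleFilter

end

/-! The mean and covariance of the ensemble satisfy, almost surely, the very recursion that defines
the Kalman filter (`ensMean_affine`, `ensCov_affine`); the two differ only in the starting point. So
the theorem splits into a deterministic stability estimate and a law of large numbers for the
initial sample.

Stability: positivity of `Q` gives `‖(H Q H* + R)⁻¹‖ ≤ r` for every positive bound `r` of `‖R⁻¹‖`,
whatever the size of `Q`. With the resolvent identity (`gain_sub_gain`) one step turns an error `e`
into at most a constant times `e + e ^ 2`, where the constant involves bounds for the inputs and for
the Kalman pair but not for the random ensemble pair. After `k` steps the error is at most `c * (g +
g ^ 2 ^ k)`, with `g` the initial error (`exists_kalman_stability`). Moments at time `k` thus reduce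
to higher moments of `g`.

Law of large numbers: in a Hilbert space the `2n`-th moment of a sum of `N` i.i.d. centred variables
is at most a constant times `N ^ n`, with no dependence on dimension (`integral_norm_sum_pow_le`).
For the covariance the operator norm is not a Hilbert norm, so `x ⊗ x` is placed in the completed
Hilbert tensor product, whose norm dominates it (`exists_momentRate_initial`). -/

namespace EnsembleFilter

/-! ### Even moments of sums of i.i.d. centred Hilbert space variables -/

section Moments

theorem pow_mul_pow_le_add {r t : ℝ} (hr : 0 ≤ r) (ht : 0 ≤ t) (a b : ℕ) :
    r ^ a * t ^ b ≤ r ^ (a + b) + t ^ (a + b) := by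
  rcases le_total r t with h | h
  · calc r ^ a * t ^ b ≤ t ^ a * t ^ b := by gcongr
      _ = t ^ (a + b) := (pow_add t a b).symm
      _ ≤ _ := le_add_of_nonneg_left (by positivity)
  · calc r ^ a * t ^ b ≤ r ^ a * r ^ b := by gcongr
      _ = r ^ (a + b) := (pow_add r a b).symm
      _ ≤ _ := le_add_of_nonneg_right (by positivity)

/-- First order expansion of `(‖s‖² + 2⟪s, y⟫ + ‖y‖²) ^ (n + 1)` with a remainder that is at least
quadratic in `t = ‖y‖`. -/
theorem exists_pow_expansion_le (n : ℕ) : ∃ c : ℝ, 0 ≤ c ∧ ∀ r t q : ℝ, 0 ≤ r → 0 ≤ t →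
    |q| ≤ 2 * (r * t) →
    (r ^ 2 + q + t ^ 2) ^ (n + 1) ≤
      r ^ (2 * (n + 1)) + (n + 1) * r ^ (2 * n) * q
        + c * (r ^ (2 * n) * t ^ 2 + t ^ (2 * (n + 1))) := by
  induction n with
  | zero => exact ⟨1, zero_le_one, fun r t q hr ht hq => by simp; nlinarith [sq_nonneg t]⟩
  | succ n ih =>
    obtain ⟨c, hc, h⟩ := ih
    -- Multiplying the bound for `n` by `r² + q + t²` leaves `u r² t²` once, the terms in `q²` and
    -- `q t²`, which cost `12 (n + 1)`, and the old remainder times `2 (r² + t²)`, which costs `6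
    -- c`; here `u = r ^ (2n)`, and mixed monomials go to the two extreme ones by `m1` and `m2`.
    refine ⟨1 + 12 * (n + 1) + 6 * c, by positivity, fun r t q hr ht hq => ?_⟩
    obtain ⟨hq1, hq2⟩ := abs_le.1 hq
    have hA0 : 0 ≤ r ^ 2 + q + t ^ 2 := by nlinarith [sq_nonneg (r - t)]
    have hA1 : r ^ 2 + q + t ^ 2 ≤ 2 * (r ^ 2 + t ^ 2) := by nlinarith [sq_nonneg (r - t)]
    have hq3 : q ^ 2 ≤ 4 * (r ^ 2 * t ^ 2) := by
      calc q ^ 2 = |q| ^ 2 := (sq_abs q).symm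
        _ ≤ (2 * (r * t)) ^ 2 := by gcongr
        _ = _ := by ring
    have hqt : q * t ^ 2 ≤ 4 * (t ^ 2 * (r ^ 2 + t ^ 2)) := by
      have : q * t ^ 2 ≤ 2 * (r * t) * t ^ 2 := by gcongr
      nlinarith [mul_nonneg (sq_nonneg t) (sq_nonneg (r - t)),
        mul_nonneg (sq_nonneg t) (sq_nonneg r), mul_nonneg (sq_nonneg t) (sq_nonneg t)]
    set u := r ^ (2 * n) with hu
    set v := t ^ (2 * n) with hv
    have hu0 : 0 ≤ u := by positivity
    have hv0 : 0 ≤ v := by positivity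
    have m1 : u * t ^ 2 ≤ u * r ^ 2 + v * t ^ 2 := by
      have := pow_mul_pow_le_add hr ht (2 * n) 2
      simpa only [pow_add, ← hu, ← hv] using this
    have m2 : r ^ 2 * v ≤ u * r ^ 2 + v * t ^ 2 := by
      have := pow_mul_pow_le_add hr ht 2 (2 * n)
      rw [add_comm 2 (2 * n)] at this
      simpa only [pow_add, ← hu, ← hv] using this
    have e1 : r ^ (2 * (n + 1)) = u * r ^ 2 := by rw [hu]; ring
    have e2 : t ^ (2 * (n + 1)) = v * t ^ 2 := by rw [hv]; ring
    have e3 : r ^ (2 * (n + 1 + 1)) = u * r ^ 4 := by rw [hu]; ring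
    have e4 : t ^ (2 * (n + 1 + 1)) = v * t ^ 4 := by rw [hv]; ring
    have hmul := mul_le_mul_of_nonneg_right (h r t q hr ht hq) hA0
    rw [pow_succ _ (n + 1)]
    refine hmul.trans ?_
    rw [e1, e2, e3, e4, ← hu]
    push_cast
    have t2 := sq_nonneg t
    have k1 : (n + 1) * (u * (q ^ 2)) ≤ (n + 1) * (u * (4 * (r ^ 2 * t ^ 2))) := by gcongr
    have k2 : (n + 1) * (u * (q * t ^ 2)) ≤ (n + 1) * (u * (4 * (t ^ 2 * (r ^ 2 + t ^ 2)))) := by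
      gcongr
    have k3 : c * (u * t ^ 2 + v * t ^ 2) * (r ^ 2 + q + t ^ 2) ≤
        c * (u * t ^ 2 + v * t ^ 2) * (2 * (r ^ 2 + t ^ 2)) := by gcongr
    have k4 := mul_le_mul_of_nonneg_left m1 t2
    have k5 := mul_le_mul_of_nonneg_left m2 t2
    have k6 := mul_le_mul_of_nonneg_left k4 hc
    have k7 := mul_le_mul_of_nonneg_left k5 hc
    have k8 := mul_le_mul_of_nonneg_left k4 (by positivity : (0 : ℝ) ≤ n + 1)
    have p1 : 0 ≤ u * r ^ 2 * t ^ 2 := by positivity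
    have p2 : 0 ≤ v * t ^ 4 := by positivity
    have p3 : 0 ≤ c * (u * r ^ 2 * t ^ 2) := by positivity
    have p4 : 0 ≤ c * (v * t ^ 4) := by positivity
    have p5 : 0 ≤ (n + 1) * (v * t ^ 4) := by positivity
    linarith

/-- The constant in `exists_pow_expansion_le`. -/
noncomputable def expansionConst (n : ℕ) : ℝ := (exists_pow_expansion_le n).choose

theorem expansionConst_nonneg (n : ℕ) : 0 ≤ expansionConst n :=
  (exists_pow_expansion_le n).choose_spec.1

/-- The term linear in `y` is kept as an exact inner product, not estimated, so that it can cancel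
under integration. -/
theorem norm_add_pow_le {G : Type*} [NormedAddCommGroup G] [InnerProductSpace ℝ G] (n : ℕ)
    (y s : G) :
    ‖y + s‖ ^ (2 * (n + 1)) ≤
      ‖s‖ ^ (2 * (n + 1)) + 2 * (n + 1) * (‖s‖ ^ (2 * n) * inner ℝ y s)
        + expansionConst n * (‖y‖ ^ 2 * ‖s‖ ^ (2 * n) + ‖y‖ ^ (2 * (n + 1))) := by
  have h := (exists_pow_expansion_le n).choose_spec.2 ‖s‖ ‖y‖ (2 * inner ℝ y s)
    (norm_nonneg _) (norm_nonneg _) (by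
      rw [abs_mul, abs_two]
      have := abs_real_inner_le_norm y s
      nlinarith)
  rw [pow_mul, norm_add_sq_real]
  refine (le_of_eq ?_).trans (h.trans (le_of_eq ?_))
  · ring
  · rw [← expansionConst]; ring

/-- By Fubini the linear term vanishes, since `y` is centred and `s` is frozen in the inner
integral; only the remainder quadratic in `y` survives. -/
theorem integral_norm_add_pow_le {E T G : Type*} [MeasurableSpace E] [MeasurableSpace T]
    [NormedAddCommGroup G] [InnerProductSpace ℝ G] [CompleteSpace G]
    (μ : Measure E) [IsProbabilityMeasure μ] (ν : Measure T) [IsProbabilityMeasure ν]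
    {y : E → G} {s : T → G} (hy : ∀ q : ℕ, MemLp y q μ) (hs : ∀ q : ℕ, MemLp s q ν)
    (hy0 : ∫ x, y x ∂μ = 0) (n : ℕ) :
    ∫ z, ‖y z.1 + s z.2‖ ^ (2 * (n + 1)) ∂(μ.prod ν) ≤
      ∫ z, ‖s z‖ ^ (2 * (n + 1)) ∂ν
        + expansionConst n * ((∫ x, ‖y x‖ ^ 2 ∂μ) * (∫ z, ‖s z‖ ^ (2 * n) ∂ν)
          + ∫ x, ‖y x‖ ^ (2 * (n + 1)) ∂μ) := by
  have iy (q : ℕ) : Integrable (fun x => ‖y x‖ ^ q) μ := (hy q).integrable_norm_pow'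
  have is (q : ℕ) : Integrable (fun x => ‖s x‖ ^ q) ν := (hs q).integrable_norm_pow'
  have isy (q : ℕ) : Integrable (fun z : E × T => ‖y z.1 + s z.2‖ ^ q) (μ.prod ν) :=
    (((hy q).comp_fst ν).add ((hs q).comp_snd μ)).integrable_norm_pow'
  have i1 : Integrable (fun z : E × T => ‖s z.2‖ ^ (2 * (n + 1))) (μ.prod ν) :=
    (is _).comp_snd μ
  have i3 : Integrable (fun z : E × T => ‖y z.1‖ ^ 2 * ‖s z.2‖ ^ (2 * n)) (μ.prod ν) :=
    (iy 2).mul_prod (is (2 * n))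
  have i4 : Integrable (fun z : E × T => ‖y z.1‖ ^ (2 * (n + 1))) (μ.prod ν) :=
    (iy _).comp_fst ν
  have i2 : Integrable (fun z : E × T => ‖s z.2‖ ^ (2 * n) * inner ℝ (y z.1) (s z.2))
      (μ.prod ν) := by
    have hb : Integrable (fun z : E × T => ‖y z.1‖ ^ 1 * ‖s z.2‖ ^ (2 * n + 1)) (μ.prod ν) :=
      (iy 1).mul_prod (is (2 * n + 1))
    refine hb.mono ?_ (ae_of_all _ fun z => ?_)
    · have h1 : AEStronglyMeasurable (fun z : E × T => y z.1) (μ.prod ν) :=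
        ((hy 1).comp_fst ν).aestronglyMeasurable
      have h2 : AEStronglyMeasurable (fun z : E × T => s z.2) (μ.prod ν) :=
        ((hs 1).comp_snd μ).aestronglyMeasurable
      exact (h2.norm.pow _).mul (h1.inner h2)
    · have := abs_real_inner_le_norm (y z.1) (s z.2)
      calc ‖‖s z.2‖ ^ (2 * n) * inner ℝ (y z.1) (s z.2)‖
          = ‖s z.2‖ ^ (2 * n) * |inner ℝ (y z.1) (s z.2)| := by simp
        _ ≤ ‖s z.2‖ ^ (2 * n) * (‖y z.1‖ * ‖s z.2‖) := by gcongr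
        _ = ‖y z.1‖ ^ 1 * ‖s z.2‖ ^ (2 * n + 1) := by ring
        _ ≤ _ := le_abs_self _
  have z2 : ∫ z : E × T, ‖s z.2‖ ^ (2 * n) * inner ℝ (y z.1) (s z.2) ∂(μ.prod ν) = 0 := by
    rw [integral_prod_symm _ i2]
    refine integral_eq_zero_of_ae (ae_of_all _ fun t => ?_)
    have : ∫ x, inner ℝ (y x) (s t) ∂μ = 0 := by
      simp_rw [fun x => real_inner_comm (s t) (y x)]
      rw [integral_inner (memLp_one_iff_integrable.1 (by simpa using hy 1)), hy0, inner_zero_right]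
    simp only [integral_const_mul, this, mul_zero, Pi.zero_apply]
  calc ∫ z, ‖y z.1 + s z.2‖ ^ (2 * (n + 1)) ∂(μ.prod ν)
      ≤ ∫ z : E × T, (‖s z.2‖ ^ (2 * (n + 1))
          + 2 * (n + 1) * (‖s z.2‖ ^ (2 * n) * inner ℝ (y z.1) (s z.2))
          + expansionConst n * (‖y z.1‖ ^ 2 * ‖s z.2‖ ^ (2 * n) + ‖y z.1‖ ^ (2 * (n + 1))))
            ∂(μ.prod ν) :=
        integral_mono (isy _) ((i1.add (i2.const_mul _)).add ((i3.add i4).const_mul _))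
          fun z => norm_add_pow_le n _ _
    _ = _ := by
        have j2 := i2.const_mul (2 * ((n : ℝ) + 1))
        have j12 : Integrable (fun z : E × T => ‖s z.2‖ ^ (2 * (n + 1))
          + 2 * (n + 1) * (‖s z.2‖ ^ (2 * n) * inner ℝ (y z.1) (s z.2))) (μ.prod ν) := i1.add j2
        have j34 : Integrable (fun z : E × T => expansionConst n *
          (‖y z.1‖ ^ 2 * ‖s z.2‖ ^ (2 * n) + ‖y z.1‖ ^ (2 * (n + 1)))) (μ.prod ν) :=
          (i3.add i4).const_mul _
        rw [integral_add j12 j34, integral_add i1 j2, integral_const_mul, integral_const_mul, z2,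
          integral_add i3 i4, integral_prod_mul (fun x => ‖y x‖ ^ 2) (fun z => ‖s z‖ ^ (2 * n)),
          integral_fun_snd (μ := μ) (ν := ν) (fun z => ‖s z‖ ^ (2 * (n + 1))),
          integral_fun_fst (μ := μ) (ν := ν) (fun z => ‖y z‖ ^ (2 * (n + 1)))]
        simp

/-- Constants of the moment inequality for sums of independent centred variables whose moments of
order `2 * j` are bounded by `K j`. -/
noncomputable def sumMomentConst (K : ℕ → ℝ) : ℕ → ℝ
  | 0 => 1
  | n + 1 => expansionConst n * (K 1 * sumMomentConst K n + K (n + 1))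

theorem memLp_pi_sum {E G : Type*} [MeasurableSpace E] [NormedAddCommGroup G]
    {μ : Measure E} [IsProbabilityMeasure μ] {y : E → G} {q : ENNReal} (hy : MemLp y q μ) (N : ℕ) :
    MemLp (fun x : Fin N → E => ∑ i, y (x i)) q (Measure.pi fun _ => μ) :=
  memLp_finsetSum _ fun i _ => hy.comp_measurePreserving (measurePreserving_eval _ i)

/-- Induction on the order, and inside it on the number of summands: one more summand raises the
moment of order `2 (n + 1)` by at most a constant times the moment of order `2n`, hence by a
multiple of `(N + 1) ^ n`, and these increments add up to order `N ^ (n + 1)`. -/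
theorem integral_norm_sum_pow_le {E G : Type*} [MeasurableSpace E]
    [NormedAddCommGroup G] [InnerProductSpace ℝ G] [CompleteSpace G]
    (μ : Measure E) [IsProbabilityMeasure μ] {y : E → G} (hy : ∀ q : ℕ, MemLp y q μ)
    (hy0 : ∫ x, y x ∂μ = 0) {K : ℕ → ℝ} (hK : ∀ j, 1 ≤ j → ∫ x, ‖y x‖ ^ (2 * j) ∂μ ≤ K j)
    (n : ℕ) : 0 ≤ sumMomentConst K n ∧ ∀ N : ℕ,
    ∫ x, ‖∑ i, y (x i)‖ ^ (2 * n) ∂(Measure.pi fun _ : Fin N => μ) ≤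
      sumMomentConst K n * (N : ℝ) ^ n := by
  have hK0 (j : ℕ) (hj : 1 ≤ j) : 0 ≤ K j :=
    (integral_nonneg fun x => by positivity).trans (hK j hj)
  induction n with
  | zero => simp [sumMomentConst]
  | succ n ih =>
    obtain ⟨hD, ih⟩ := ih
    have hc := expansionConst_nonneg n
    have hD' : 0 ≤ sumMomentConst K (n + 1) := by
      have := hK0 1 le_rfl
      have := hK0 (n + 1) (by omega)
      rw [sumMomentConst]; positivity
    refine ⟨hD', fun N => ?_⟩
    induction N with
    | zero => simp
    | succ N ihN =>
      have hmp := measurePreserving_piFinSuccAbove (fun _ : Fin (N + 1) => μ) 0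
      have h1 : ∫ x, ‖∑ i, y (x i)‖ ^ (2 * (n + 1)) ∂(Measure.pi fun _ : Fin (N + 1) => μ) =
          ∫ z : E × (Fin N → E), ‖y z.1 + ∑ i, y (z.2 i)‖ ^ (2 * (n + 1))
            ∂(μ.prod (Measure.pi fun _ : Fin N => μ)) := by
        rw [← hmp.integral_comp']
        refine integral_congr_ae (ae_of_all _ fun x => ?_)
        simp only [Fin.sum_univ_succ]
        rfl
      rw [h1]
      refine (integral_norm_add_pow_le μ _ hy (fun q => memLp_pi_sum (hy q) N) hy0 n).trans ?_
      have hNn : (N : ℝ) ^ n ≤ ((N : ℝ) + 1) ^ n := by gcongr; linarith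
      have hN1 : (1 : ℝ) ≤ ((N : ℝ) + 1) ^ n := one_le_pow₀ (by linarith [Nat.cast_nonneg (α := ℝ) N])
      have h2 : (∫ x, ‖y x‖ ^ 2 ∂μ) *
          ∫ x, ‖∑ i, y (x i)‖ ^ (2 * n) ∂(Measure.pi fun _ : Fin N => μ) ≤
          K 1 * (sumMomentConst K n * ((N : ℝ) + 1) ^ n) :=
        mul_le_mul (hK 1 le_rfl) ((ih N).trans (by gcongr))
          (integral_nonneg fun x => by positivity) (hK0 1 le_rfl)
      have h3 : ∫ x, ‖y x‖ ^ (2 * (n + 1)) ∂μ ≤ K (n + 1) * ((N : ℝ) + 1) ^ n :=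
        (hK (n + 1) (by omega)).trans (le_mul_of_one_le_right (hK0 _ (by omega)) hN1)
      have h4 : (N : ℝ) ^ (n + 1) + ((N : ℝ) + 1) ^ n ≤ ((N : ℝ) + 1) ^ (n + 1) := by
        rw [pow_succ, pow_succ]
        nlinarith [mul_le_mul_of_nonneg_right hNn (Nat.cast_nonneg (α := ℝ) N)]
      calc _ ≤ sumMomentConst K (n + 1) * (N : ℝ) ^ (n + 1) + expansionConst n *
            (K 1 * (sumMomentConst K n * ((N : ℝ) + 1) ^ n) + K (n + 1) * ((N : ℝ) + 1) ^ n) := by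
              gcongr
        _ = sumMomentConst K (n + 1) * ((N : ℝ) ^ (n + 1) + ((N : ℝ) + 1) ^ n) := by
              simp only [sumMomentConst]; ring
        _ ≤ _ := by push_cast; gcongr

end Moments

/-! ### Bounds and local Lipschitz estimates for the Kalman update -/

section AnalysisStep

theorem apply_inverse_apply {W : Type*} [NormedAddCommGroup W] [InnerProductSpace ℝ W]
    {A : W →L[ℝ] W} (hA : IsUnit A) (w : W) :
    A (Ring.inverse A w) = w := by
  rw [← mul_apply_eq_comp, Ring.mul_inverse_cancel _ hA, one_apply_eq_self]

theorem norm_inverse_le_of_sq_le {W : Type*} [NormedAddCommGroup W] [InnerProductSpace ℝ W]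
    {A : W →L[ℝ] W} (hA : IsUnit A) {r : ℝ} (hr : 0 ≤ r)
    (h : ∀ u, ‖u‖ ^ 2 ≤ r * inner ℝ (A u) u) : ‖Ring.inverse A‖ ≤ r := by
  refine ContinuousLinearMap.opNorm_le_bound _ hr fun w => ?_
  set u := Ring.inverse A w with hu
  have h1 := h u
  rw [hu, apply_inverse_apply hA, ← hu] at h1
  have h2 : r * inner ℝ w u ≤ r * (‖w‖ * ‖u‖) := by
    gcongr; exact real_inner_le_norm w u
  rcases (norm_nonneg u).eq_or_lt with h0 | h0
  · rw [← h0]; positivity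
  · nlinarith

theorem IsPosDef.inner_nonneg {W : Type*} [NormedAddCommGroup W] [InnerProductSpace ℝ W]
    {R : W →L[ℝ] W} (hR : IsPosDef R) (u : W) :
    0 ≤ inner ℝ (R u) u := by
  obtain ⟨-, α, hα, h⟩ := hR
  exact (by positivity : 0 ≤ α * ‖u‖ ^ 2).trans (h u)

theorem norm_comp_le_of_le {X Y Z : Type*} [NormedAddCommGroup X] [NormedSpace ℝ X]
    [NormedAddCommGroup Y] [NormedSpace ℝ Y] [NormedAddCommGroup Z] [NormedSpace ℝ Z]
    {A : Y →L[ℝ] Z} {B : X →L[ℝ] Y} {a b : ℝ} (hA : ‖A‖ ≤ a) (hB : ‖B‖ ≤ b) :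
    ‖A ∘L B‖ ≤ a * b :=
  (A.opNorm_comp_le B).trans
    (mul_le_mul hA hB (norm_nonneg _) ((norm_nonneg _).trans hA))

theorem norm_apply_le_of_le {X Y : Type*} [NormedAddCommGroup X] [NormedSpace ℝ X]
    [NormedAddCommGroup Y] [NormedSpace ℝ Y] {A : X →L[ℝ] Y} {x : X} {a b : ℝ} (hA : ‖A‖ ≤ a) (hx : ‖x‖ ≤ b) :
    ‖A x‖ ≤ a * b :=
  (A.le_opNorm x).trans (mul_le_mul hA hx (norm_nonneg _) ((norm_nonneg _).trans hA))

variable {V W : Type*} [NormedAddCommGroup V] [InnerProductSpace ℝ V] [CompleteSpace V]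
  [NormedAddCommGroup W] [InnerProductSpace ℝ W] [CompleteSpace W]

theorem isUnit_of_coercive {A : W →L[ℝ] W} {α : ℝ} (hα : 0 < α)
    (h : ∀ u, α * ‖u‖ ^ 2 ≤ inner ℝ (A u) u) : IsUnit A :=
  A.isUnit_of_forall_le_norm_inner_map (c := ⟨α, hα.le⟩) hα fun u => by
    rw [mul_comm]
    exact (h u).trans (le_abs_self _)

theorem IsPosDef.isUnit {R : W →L[ℝ] W} (hR : IsPosDef R) : IsUnit R := by
  obtain ⟨-, α, hα, h⟩ := hR
  exact isUnit_of_coercive hα h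

/-- Follows from positivity of `R` at the vector `r w - R⁻¹ w`. It trades the uncontrolled
coercivity constant of `R` for the given bound on `R⁻¹`. -/
theorem IsPosDef.sq_norm_le {R : W →L[ℝ] W} (hR : IsPosDef R) {r : ℝ}
    (hr : ‖Ring.inverse R‖ ≤ r) (hr0 : 0 < r) (w : W) : ‖w‖ ^ 2 ≤ r * inner ℝ (R w) w := by
  set z := Ring.inverse R w with hz
  have hRz : R z = w := apply_inverse_apply hR.isUnit w
  have h1 := hR.inner_nonneg (r • w - z)
  have h2 : inner ℝ (R w) z = ‖w‖ ^ 2 := by rw [hR.1, hRz, real_inner_self_eq_norm_sq]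
  have h3 : inner ℝ w z ≤ r * ‖w‖ ^ 2 := by
    calc inner ℝ w z ≤ ‖w‖ * ‖z‖ := real_inner_le_norm _ _
      _ ≤ ‖w‖ * (r * ‖w‖) := by
          gcongr
          exact (ContinuousLinearMap.le_opNorm _ _).trans (by gcongr)
      _ = _ := by ring
  simp only [map_sub, map_smul, inner_sub_left, inner_sub_right, hRz, real_inner_smul_left,
    real_inner_smul_right, h2, real_inner_self_eq_norm_sq] at h1
  have h4 : 0 ≤ r * (r * inner ℝ (R w) w - ‖w‖ ^ 2) := by nlinarith
  linarith [nonneg_of_mul_nonneg_right h4 hr0]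

theorem sq_norm_le_innovation {H : V →L[ℝ] W} {R : W →L[ℝ] W} {Q : V →L[ℝ] V}
    (hR : IsPosDef R) (hQ : Q.IsPositive) {r : ℝ} (hr : ‖Ring.inverse R‖ ≤ r) (hr0 : 0 < r)
    (w : W) : ‖w‖ ^ 2 ≤ r * inner ℝ ((H ∘L Q ∘L H.adjoint + R) w) w := by
  refine (hR.sq_norm_le hr hr0 w).trans ?_
  gcongr
  have := hQ.inner_nonneg_left (H.adjoint w)
  rw [ContinuousLinearMap.adjoint_inner_right] at this
  simpa [inner_add_left] using this

theorem isUnit_innovation (H : V →L[ℝ] W) {R : W →L[ℝ] W} {Q : V →L[ℝ] V}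
    (hR : IsPosDef R) (hQ : Q.IsPositive) : IsUnit (H ∘L Q ∘L H.adjoint + R) := by
  obtain ⟨r, hr, hr0⟩ : ∃ r, ‖Ring.inverse R‖ ≤ r ∧ 0 < r :=
    -- The summand `1` keeps `r` positive even when `W` is trivial.
    ⟨‖Ring.inverse R‖ + 1, by linarith, by positivity⟩
  refine isUnit_of_coercive (inv_pos.2 hr0) fun w => ?_
  rw [inv_mul_le_iff₀ hr0]
  exact sq_norm_le_innovation hR hQ hr hr0 w

/-- Adding the positive operator `H Q H*` can only improve coercivity, so the bound does not involve
`Q`. -/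
theorem norm_inverse_innovation_le (H : V →L[ℝ] W) {R : W →L[ℝ] W} {Q : V →L[ℝ] V}
    (hR : IsPosDef R) (hQ : Q.IsPositive) {r : ℝ} (hr : ‖Ring.inverse R‖ ≤ r) (hr0 : 0 < r) :
    ‖Ring.inverse (H ∘L Q ∘L H.adjoint + R)‖ ≤ r :=
  norm_inverse_le_of_sq_le (isUnit_innovation H hR hQ) hr0.le (sq_norm_le_innovation hR hQ hr hr0)

theorem norm_adjoint_le {H : V →L[ℝ] W} {h : ℝ} (hH : ‖H‖ ≤ h) : ‖H.adjoint‖ ≤ h := by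
  rwa [LinearIsometryEquiv.norm_map]

theorem norm_gain_le {H : V →L[ℝ] W} {R : W →L[ℝ] W} {Q : V →L[ℝ] V} (hR : IsPosDef R)
    (hQ : Q.IsPositive) {r h : ℝ} (hr : ‖Ring.inverse R‖ ≤ r) (hr0 : 0 < r) (hH : ‖H‖ ≤ h) :
    ‖gain H R Q‖ ≤ ‖Q‖ * (h * r) :=
  norm_comp_le_of_le le_rfl <| norm_comp_le_of_le (norm_adjoint_le hH)
    (norm_inverse_innovation_le H hR hQ hr hr0)

/-- This is the resolvent identity `B⁻¹ (A - B) A⁻¹ = B⁻¹ - A⁻¹`. Outside the difference, `Q` occurs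
only within an inverse, so the Lipschitz constant depends on `‖P‖` alone. -/
theorem gain_sub_gain {H : V →L[ℝ] W} {R : W →L[ℝ] W} {Q P : V →L[ℝ] V} (hR : IsPosDef R)
    (hQ : Q.IsPositive) (hP : P.IsPositive) :
    gain H R Q - gain H R P =
      (Q - P) ∘L H.adjoint ∘L Ring.inverse (H ∘L Q ∘L H.adjoint + R) -
        gain H R P ∘L H ∘L (Q - P) ∘L H.adjoint ∘L Ring.inverse (H ∘L Q ∘L H.adjoint + R) := by
  have hA : Ring.inverse (H ∘L P ∘L H.adjoint + R) ∘L
      (H ∘L (Q - P) ∘L H.adjoint) ∘L Ring.inverse (H ∘L Q ∘L H.adjoint + R) =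
      Ring.inverse (H ∘L P ∘L H.adjoint + R) - Ring.inverse (H ∘L Q ∘L H.adjoint + R) := by
    have e : H ∘L (Q - P) ∘L H.adjoint =
        (H ∘L Q ∘L H.adjoint + R) - (H ∘L P ∘L H.adjoint + R) := by
      ext; simp
    rw [e]
    have h1 := Ring.mul_inverse_cancel _ (isUnit_innovation H hR hQ)
    have h2 := Ring.inverse_mul_cancel _ (isUnit_innovation H hR hP)
    generalize H ∘L Q ∘L H.adjoint + R = A at *
    generalize H ∘L P ∘L H.adjoint + R = B at *
    change Ring.inverse B * ((A - B) * Ring.inverse A) = _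
    rw [sub_mul, mul_sub, h1, ← mul_assoc, h2, mul_one, one_mul]
  have hB := congrArg (fun T => P ∘L H.adjoint ∘L T) hA
  simp only [gain]
  ext w
  have hw := congrArg (fun T => T w) hB
  simp only [ContinuousLinearMap.comp_apply, sub_apply, map_sub] at hw ⊢
  rw [hw]
  abel

theorem norm_gain_sub_gain_le {H : V →L[ℝ] W} {R : W →L[ℝ] W} {Q P : V →L[ℝ] V}
    (hR : IsPosDef R) (hQ : Q.IsPositive) (hP : P.IsPositive) {r h : ℝ}
    (hr : ‖Ring.inverse R‖ ≤ r) (hr0 : 0 < r) (hH : ‖H‖ ≤ h) :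
    ‖gain H R Q - gain H R P‖ ≤ (h * r * (1 + ‖P‖ * h ^ 2 * r)) * ‖Q - P‖ := by
  have hi := norm_inverse_innovation_le H hR hQ hr hr0
  rw [gain_sub_gain hR hQ hP]
  have h1 : ‖(Q - P) ∘L H.adjoint ∘L Ring.inverse (H ∘L Q ∘L H.adjoint + R)‖ ≤
      ‖Q - P‖ * (h * r) :=
    norm_comp_le_of_le le_rfl (norm_comp_le_of_le (norm_adjoint_le hH) hi)
  have h2 := norm_comp_le_of_le (norm_gain_le hR hP hr hr0 hH) (norm_comp_le_of_le hH h1)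
  refine (norm_sub_le _ _).trans ((add_le_add h1 h2).trans (le_of_eq ?_))
  ring

/-- Expanded around the reference pair `(y, P)`: every factor is a difference or a quantity at the
reference pair, and the product of two differences produces the quadratic term of the error. -/
theorem analysisMean_sub {H : V →L[ℝ] W} {R : W →L[ℝ] W} {d : W} {x y : V} {Q P : V →L[ℝ] V} :
    analysisMean H R d x Q - analysisMean H R d y P =
      (x - y) + (gain H R Q - gain H R P) (d - H y)
        - (gain H R Q - gain H R P) (H (x - y)) - gain H R P (H (x - y)) := by
  simp only [analysisMean, sub_apply, map_sub]
  abel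

theorem analysisCov_sub {H : V →L[ℝ] W} {R : W →L[ℝ] W} {Q P : V →L[ℝ] V} :
    analysisCov H R Q - analysisCov H R P =
      (Q - P) - (gain H R Q - gain H R P) ∘L H ∘L (Q - P)
        - (gain H R Q - gain H R P) ∘L H ∘L P - gain H R P ∘L H ∘L (Q - P) := by
  ext u
  simp only [analysisCov, sub_apply, map_sub, ContinuousLinearMap.comp_apply]
  abel

theorem isPositive_analysisCov {H : V →L[ℝ] W} {R : W →L[ℝ] W} {Q : V →L[ℝ] V}
    (hR : IsPosDef R) (hQ : Q.IsPositive) : (analysisCov H R Q).IsPositive := by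
  set Y : V → W := fun u => Ring.inverse (H ∘L Q ∘L H.adjoint + R) (H (Q u)) with hY
  have hsym (u v : V) : inner ℝ (Q u) v = inner ℝ u (Q v) := hQ.isSymmetric u v
  have hYe (u : V) : H (Q u) = H (Q (H.adjoint (Y u))) + R (Y u) :=
    (apply_inverse_apply (isUnit_innovation H hR hQ) (H (Q u))).symm
  have hA (u v : V) : inner ℝ (analysisCov H R Q u) v =
      inner ℝ (Q u) v - inner ℝ (Y u) (H (Q v)) := by
    have : analysisCov H R Q u = Q u - Q (H.adjoint (Y u)) := rfl
    rw [this, inner_sub_left, hsym (H.adjoint (Y u)), ContinuousLinearMap.adjoint_inner_left]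
  have hQ2 (a b : W) : inner ℝ (H (Q (H.adjoint a))) b = inner ℝ a (H (Q (H.adjoint b))) := by
    rw [← ContinuousLinearMap.adjoint_inner_right, hsym, ContinuousLinearMap.adjoint_inner_left]
  refine (ContinuousLinearMap.isPositive_def).2 ⟨fun u v => ?_, fun u => ?_⟩
  · change inner ℝ (analysisCov H R Q u) v = inner ℝ u (analysisCov H R Q v)
    rw [real_inner_comm _ u, hA, hA, hsym u v, real_inner_comm u, hYe v, hYe u,
      real_inner_comm _ (Y v), inner_add_right, inner_add_left, hQ2, hR.1]
  -- Joseph form: `⟪𝒜(Q) u, u⟫ = ⟪Q z, z⟫ + ⟪R (Y u), Y u⟫` with `z = u - H* (Y u)`.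
  · have h1 := hQ.inner_nonneg_left (u - H.adjoint (Y u))
    have h2 := hR.inner_nonneg (Y u)
    have h3 : inner ℝ (H (Q u)) (Y u) =
        inner ℝ (H (Q (H.adjoint (Y u)))) (Y u) + inner ℝ (R (Y u)) (Y u) := by
      rw [hYe u, inner_add_left]
    have h4 : inner ℝ (Q u) (H.adjoint (Y u)) = inner ℝ (H (Q u)) (Y u) :=
      ContinuousLinearMap.adjoint_inner_right _ _ _
    have h5 : inner ℝ (Q (H.adjoint (Y u))) u = inner ℝ (H (Q u)) (Y u) := by
      rw [hsym, real_inner_comm, h4]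
    have h6 : inner ℝ (Q (H.adjoint (Y u))) (H.adjoint (Y u)) =
        inner ℝ (H (Q (H.adjoint (Y u)))) (Y u) := ContinuousLinearMap.adjoint_inner_right _ _ _
    rw [ContinuousLinearMap.reApplyInnerSelf_apply, hA, real_inner_comm (H (Q u))]
    simp only [map_sub, inner_sub_left, inner_sub_right, h4, h5, h6] at h1
    simp only [RCLike.re_to_real]
    linarith

theorem norm_analysisCov_le {H : V →L[ℝ] W} {R : W →L[ℝ] W} {Q : V →L[ℝ] V} (hR : IsPosDef R)
    (hQ : Q.IsPositive) {L : ℝ} (hL : 1 ≤ L) (hr : ‖Ring.inverse R‖ ≤ L) (hH : ‖H‖ ≤ L)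
    (hQL : ‖Q‖ ≤ L) : ‖analysisCov H R Q‖ ≤ L + L ^ 5 := by
  have h1 := norm_comp_le_of_le (norm_gain_le hR hQ hr (by linarith) hH)
    (norm_comp_le_of_le hH hQL)
  refine (norm_sub_le _ _).trans (add_le_add hQL (h1.trans ?_))
  calc ‖Q‖ * (L * L) * (L * L) ≤ L * (L * L) * (L * L) := by gcongr
    _ = _ := by ring

theorem norm_analysisMean_le {H : V →L[ℝ] W} {R : W →L[ℝ] W} {Q : V →L[ℝ] V} {d : W} {x : V}
    (hR : IsPosDef R) (hQ : Q.IsPositive) {L : ℝ} (hL : 1 ≤ L) (hr : ‖Ring.inverse R‖ ≤ L)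
    (hH : ‖H‖ ≤ L) (hQL : ‖Q‖ ≤ L) (hd : ‖d‖ ≤ L) (hx : ‖x‖ ≤ L) :
    ‖analysisMean H R d x Q‖ ≤ L + L ^ 3 * (L + L * L) := by
  have h1 := norm_apply_le_of_le (norm_gain_le hR hQ hr (by linarith) hH)
    ((norm_sub_le _ _).trans (add_le_add hd (norm_apply_le_of_le hH hx)))
  refine (norm_add_le _ _).trans (add_le_add hx (h1.trans ?_))
  calc ‖Q‖ * (L * L) * (L + L * L) ≤ L * (L * L) * (L + L * L) := by gcongr
    _ = _ := by ring

theorem norm_analysis_sub_le {H : V →L[ℝ] W} {R : W →L[ℝ] W} {Q P : V →L[ℝ] V} {d : W} {x y : V}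
    (hR : IsPosDef R) (hQ : Q.IsPositive) (hP : P.IsPositive) {L : ℝ} (hL : 1 ≤ L)
    (hr : ‖Ring.inverse R‖ ≤ L) (hH : ‖H‖ ≤ L) (hPL : ‖P‖ ≤ L) (hd : ‖d‖ ≤ L) (hy : ‖y‖ ≤ L)
    {e : ℝ} (he : ‖x - y‖ + ‖Q - P‖ ≤ e) :
    ‖analysisMean H R d x Q - analysisMean H R d y P‖ + ‖analysisCov H R Q - analysisCov H R P‖ ≤
      16 * L ^ 8 * (e + e ^ 2) := by
  have hx0 := norm_nonneg (x - y)
  have hQ0 := norm_nonneg (Q - P)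
  have he1 : ‖x - y‖ ≤ e := by linarith
  have he2 : ‖Q - P‖ ≤ e := by linarith
  have he0 : 0 ≤ e := by linarith
  have hL0 : 0 < L := by linarith
  have hG : ‖gain H R Q - gain H R P‖ ≤ 2 * L ^ 6 * e := by
    refine (norm_gain_sub_gain_le hR hQ hP hr hL0 hH).trans ?_
    calc L * L * (1 + ‖P‖ * L ^ 2 * L) * ‖Q - P‖ ≤ L * L * (L ^ 4 + L * L ^ 2 * L) * e := by
          gcongr; exact one_le_pow₀ hL
      _ = _ := by ring
  have hK : ‖gain H R P‖ ≤ L ^ 3 := by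
    refine (norm_gain_le hR hP hr hL0 hH).trans ?_
    calc ‖P‖ * (L * L) ≤ L * (L * L) := by gcongr
      _ = _ := by ring
  have hdy : ‖d - H y‖ ≤ 2 * L ^ 2 := by
    refine (norm_sub_le _ _).trans ?_
    have := norm_apply_le_of_le hH hy
    nlinarith
  have hHx := norm_apply_le_of_le hH he1
  have hHQ := norm_comp_le_of_le hH he2
  have a1 := norm_apply_le_of_le hG hdy
  have a2 := norm_apply_le_of_le hG hHx
  have a3 := norm_apply_le_of_le hK hHx
  have b1 := norm_comp_le_of_le hG hHQ
  have b2 := norm_comp_le_of_le hG (norm_comp_le_of_le hH hPL)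
  have b3 := norm_comp_le_of_le hK hHQ
  have hA : ‖analysisMean H R d x Q - analysisMean H R d y P‖ ≤
      e + 2 * L ^ 6 * e * (2 * L ^ 2) + 2 * L ^ 6 * e * (L * e) + L ^ 3 * (L * e) := by
    rw [analysisMean_sub]
    refine (norm_sub_le _ _).trans (add_le_add ?_ a3)
    refine (norm_sub_le _ _).trans (add_le_add ?_ a2)
    exact (norm_add_le _ _).trans (add_le_add he1 a1)
  have hB : ‖analysisCov H R Q - analysisCov H R P‖ ≤
      e + 2 * L ^ 6 * e * (L * e) + 2 * L ^ 6 * e * (L * L) + L ^ 3 * (L * e) := by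
    rw [analysisCov_sub]
    refine (norm_sub_le _ _).trans (add_le_add ?_ b3)
    refine (norm_sub_le _ _).trans (add_le_add ?_ b2)
    exact (norm_sub_le _ _).trans (add_le_add he2 b1)
  -- As `1 ≤ L`, all powers of `L` are absorbed into `L ^ 8`; the coefficients of `e` and `e ^ 2`
  -- then add up to `10` and `4`, within `16`.
  have c1 : e ≤ L ^ 8 * e := le_mul_of_one_le_left he0 (one_le_pow₀ hL)
  have c2 : L ^ 4 * e ≤ L ^ 8 * e := by gcongr; norm_num
  have c3 : L ^ 7 * e ^ 2 ≤ L ^ 8 * e ^ 2 := by gcongr; norm_num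
  have c4 : 0 ≤ L ^ 8 * e := by positivity
  have c5 : 0 ≤ L ^ 8 * e ^ 2 := by positivity
  linarith

end AnalysisStep

/-! ### Algebra of ensemble means and covariances -/

section EnsembleStatistics

variable {V : Type*} [NormedAddCommGroup V] [InnerProductSpace ℝ V]

theorem sum_sub_ensMean {N : ℕ} (x : Fin N → V) : ∑ i, (x i - ensMean x) = 0 := by
  rcases Nat.eq_zero_or_pos N with rfl | hN
  · simp
  · have : (N : ℝ) ≠ 0 := by positivity
    rw [Finset.sum_sub_distrib, Finset.sum_const, Finset.card_univ, Fintype.card_fin,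
      ← Nat.cast_smul_eq_nsmul ℝ, ensMean, smul_inv_smul₀ this, sub_self]

theorem ensMean_sub {N : ℕ} (hN : 1 ≤ N) (x : Fin N → V) (m : V) :
    (N : ℝ)⁻¹ • ∑ i, (x i - m) = ensMean x - m := by
  have : (N : ℝ) ≠ 0 := by positivity
  rw [Finset.sum_sub_distrib, Finset.sum_const, Finset.card_univ, Fintype.card_fin, smul_sub,
    ← Nat.cast_smul_eq_nsmul ℝ, inv_smul_smul₀ this, ensMean]

theorem ensMean_affine {N : ℕ} (hN : 1 ≤ N) (M : V →L[ℝ] V) (b : V) (x : Fin N → V) :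
    ensMean (fun i => M (x i) + b) = M (ensMean x) + b := by
  have : (N : ℝ) ≠ 0 := by positivity
  simp only [ensMean, Finset.sum_add_distrib, Finset.sum_const, Finset.card_univ,
    Fintype.card_fin, smul_add, ← Nat.cast_smul_eq_nsmul ℝ, inv_smul_smul₀ this, map_smul, map_sum]

theorem isPositive_ensCov {N : ℕ} (x : Fin N → V) : (ensCov x).IsPositive :=
  (ContinuousLinearMap.isPositive_sum _ fun _ _ =>
    InnerProductSpace.isPositive_rankOne_self _).smul_of_nonneg (by positivity)

/-- The shift cancels in the deviations. With `ensMean_affine`, this makes the forecast of the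
ensemble statistics coincide with the Kalman forecast, with no sampling error. -/
theorem ensCov_affine [CompleteSpace V] {N : ℕ} (hN : 1 ≤ N) (M : V →L[ℝ] V) (b : V)
    (x : Fin N → V) :
    ensCov (fun i => M (x i) + b) = M ∘L ensCov x ∘L M.adjoint := by
  simp only [ensCov, ensMean_affine hN, add_sub_add_right_eq_sub, ← map_sub]
  ext u
  simp [ContinuousLinearMap.adjoint_inner_right, map_sum]

/-- The ensemble covariance in terms of deviations from an arbitrary point `m`. -/
theorem ensCov_eq_sub {N : ℕ} (hN : 1 ≤ N) (x : Fin N → V) (m : V) :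
    ensCov x = (N : ℝ)⁻¹ • ∑ i, InnerProductSpace.rankOne ℝ (x i - m) (x i - m)
      - InnerProductSpace.rankOne ℝ (ensMean x - m) (ensMean x - m) := by
  have h0 : (N : ℝ) ≠ 0 := by positivity
  set e := ensMean x - m with he
  have h1 (i : Fin N) : InnerProductSpace.rankOne ℝ (x i - m) (x i - m) =
      InnerProductSpace.rankOne ℝ (x i - ensMean x) (x i - ensMean x)
        + InnerProductSpace.rankOne ℝ (x i - ensMean x) e
        + InnerProductSpace.rankOne ℝ e (x i - ensMean x)
        + InnerProductSpace.rankOne ℝ e e := by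
    have : x i - m = (x i - ensMean x) + e := by rw [he]; abel
    rw [this]
    ext u
    simp only [add_apply, InnerProductSpace.rankOne_apply, inner_add_left, smul_add, add_smul]
    abel
  have h2 : ∑ i, InnerProductSpace.rankOne ℝ (x i - ensMean x) e = 0 := by
    ext u
    simp only [sum_apply, InnerProductSpace.rankOne_apply,
      ← Finset.smul_sum, sum_sub_ensMean, smul_zero, zero_apply]
  have h3 : ∑ i, InnerProductSpace.rankOne ℝ e (x i - ensMean x) = 0 := by
    rw [← map_sum, sum_sub_ensMean, map_zero]
  simp only [h1, Finset.sum_add_distrib, h2, h3, add_zero, Finset.sum_const, Finset.card_univ,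
    Fintype.card_fin, smul_add, ← Nat.cast_smul_eq_nsmul ℝ, inv_smul_smul₀ h0, ensCov,
    add_sub_cancel_right]

end EnsembleStatistics

/-! ### Growth of the initial error along a filter path -/

section Stability

theorem pow_le_add_pow {x : ℝ} (hx : 0 ≤ x) {a b : ℕ} (ha : 1 ≤ a) (hab : a ≤ b) :
    x ^ a ≤ x + x ^ b := by
  rcases le_total x 1 with h | h
  · have := pow_le_pow_of_le_one hx h ha
    rw [pow_one] at this
    have := pow_nonneg hx b
    linarith
  · have := pow_le_pow_right₀ h hab
    linarith

theorem isPositive_kalman {V W : Type*} [NormedAddCommGroup V] [InnerProductSpace ℝ V]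
    [CompleteSpace V] [NormedAddCommGroup W] [InnerProductSpace ℝ W] [CompleteSpace W]
    (S : Problem V W) (m₀ : V) {B : V →L[ℝ] V} (hB : B.IsPositive) (k : ℕ) :
    (kalman S m₀ B k).2.IsPositive := by
  induction k with
  | zero => exact hB
  | succ k ih => exact isPositive_analysisCov (S.R_pos _ (by omega)) (ih.conj_adjoint _)

/-- One time step of a filter: the distance of two pairs (mean, covariance) grows at most
quadratically, with a constant that depends on bounds for the inputs and for the second pair. -/
theorem norm_step_sub_le {V W : Type*} [NormedAddCommGroup V] [InnerProductSpace ℝ V]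
    [CompleteSpace V] [NormedAddCommGroup W] [InnerProductSpace ℝ W] [CompleteSpace W]
    {M : V →L[ℝ] V} {b : V} {H : V →L[ℝ] W} {R : W →L[ℝ] W} {d : W} (hR : IsPosDef R)
    {x y : V} {Q P : V →L[ℝ] V} (hQ : Q.IsPositive) (hP : P.IsPositive) {L : ℝ} (hL : 1 ≤ L)
    (hM : ‖M‖ ≤ L) (hb : ‖b‖ ≤ L) (hH : ‖H‖ ≤ L) (hr : ‖Ring.inverse R‖ ≤ L) (hd : ‖d‖ ≤ L)
    (hy : ‖y‖ ≤ L) (hPL : ‖P‖ ≤ L) :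
    ‖analysisMean H R d (M y + b) (M ∘L P ∘L M.adjoint)‖ ≤
      2 * L ^ 3 + (2 * L ^ 3) ^ 3 * (2 * L ^ 3 + 2 * L ^ 3 * (2 * L ^ 3)) ∧
    ‖analysisCov H R (M ∘L P ∘L M.adjoint)‖ ≤ 2 * L ^ 3 + (2 * L ^ 3) ^ 5 ∧
    ‖analysisMean H R d (M x + b) (M ∘L Q ∘L M.adjoint) -
        analysisMean H R d (M y + b) (M ∘L P ∘L M.adjoint)‖ +
      ‖analysisCov H R (M ∘L Q ∘L M.adjoint) - analysisCov H R (M ∘L P ∘L M.adjoint)‖ ≤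
      16 * (2 * L ^ 3) ^ 8 * L ^ 4 * ((‖x - y‖ + ‖Q - P‖) + (‖x - y‖ + ‖Q - P‖) ^ 2) := by
  have hM' := norm_adjoint_le hM
  have hL3 : L ≤ L ^ 3 := le_self_pow₀ hL (by norm_num)
  have hL2 : L ≤ L ^ 2 := le_self_pow₀ hL (by norm_num)
  have hL23 : L ^ 2 ≤ L ^ 3 := pow_le_pow_right₀ hL (by norm_num)
  have hL24 : L ^ 2 ≤ L ^ 4 := pow_le_pow_right₀ hL (by norm_num)
  -- `2 * L ^ 3` serves as one bound for everything entering the update: it dominates `L`, the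
  -- forecast covariance (`L ^ 3`) and the forecast mean (`L ^ 2 + L`).
  have hLL : L ≤ 2 * L ^ 3 := by linarith
  have h1 : 1 ≤ 2 * L ^ 3 := by linarith
  have hPf : (M ∘L P ∘L M.adjoint).IsPositive := hP.conj_adjoint M
  have hQf : (M ∘L Q ∘L M.adjoint).IsPositive := hQ.conj_adjoint M
  have hPn : ‖M ∘L P ∘L M.adjoint‖ ≤ 2 * L ^ 3 :=
    (norm_comp_le_of_le hM (norm_comp_le_of_le hPL hM')).trans (by nlinarith)
  have hyn : ‖M y + b‖ ≤ 2 * L ^ 3 :=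
    (norm_add_le _ _).trans ((add_le_add (norm_apply_le_of_le hM hy) hb).trans (by nlinarith))
  refine ⟨norm_analysisMean_le hR hPf h1 (hr.trans hLL) (hH.trans hLL) hPn (hd.trans hLL) hyn,
    norm_analysisCov_le hR hPf h1 (hr.trans hLL) (hH.trans hLL) hPn, ?_⟩
  set e := ‖x - y‖ + ‖Q - P‖ with he
  have he0 : 0 ≤ e := by positivity
  have hd1 : ‖(M x + b) - (M y + b)‖ ≤ L ^ 2 * ‖x - y‖ := by
    rw [add_sub_add_right_eq_sub, ← map_sub]
    exact (norm_apply_le_of_le hM le_rfl).trans (by gcongr)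
  have hd2 : ‖M ∘L Q ∘L M.adjoint - M ∘L P ∘L M.adjoint‖ ≤ L ^ 2 * ‖Q - P‖ := by
    have : M ∘L Q ∘L M.adjoint - M ∘L P ∘L M.adjoint = M ∘L (Q - P) ∘L M.adjoint := by
      ext u; simp
    rw [this]
    refine (norm_comp_le_of_le hM (norm_comp_le_of_le le_rfl hM')).trans (le_of_eq ?_)
    ring
  refine (norm_analysis_sub_le hR hQf hPf h1 (hr.trans hLL) (hH.trans hLL) hPn (hd.trans hLL) hyn
    (e := L ^ 2 * e) ?_).trans ?_
  · rw [he, mul_add]; exact add_le_add hd1 hd2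
  · rw [mul_assoc _ (L ^ 4)]
    have : L ^ 2 * e + (L ^ 2 * e) ^ 2 ≤ L ^ 4 * (e + e ^ 2) := by
      nlinarith [mul_le_mul_of_nonneg_right hL24 he0]
    gcongr

/-- Iterates `norm_step_sub_le`. The bound `A` on the Kalman pair is carried through the induction
because the constant of the next step needs it; each step at most squares the error, whence the
exponent `2 ^ k`. Both constants are fixed before the spaces are. -/
theorem exists_kalman_stability (cM cb cH cR cd : ℕ → ℝ) (a : ℝ) (k : ℕ) :
    ∃ A c : ℝ, 0 ≤ c ∧ ∀ (V : Type*) [NormedAddCommGroup V] [InnerProductSpace ℝ V]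
      [CompleteSpace V] (W : Type*) [NormedAddCommGroup W] [InnerProductSpace ℝ W]
      [CompleteSpace W] (S : Problem V W) (m₀ : V) (B : V →L[ℝ] V), B.IsPositive →
      ‖m₀‖ ≤ a → ‖B‖ ≤ a →
      (∀ j : ℕ, 1 ≤ j → j ≤ k →
        ‖S.M j‖ ≤ cM j ∧ ‖S.b j‖ ≤ cb j ∧ ‖S.H j‖ ≤ cH j ∧
          ‖Ring.inverse (S.R j)‖ ≤ cR j ∧ ‖S.d j‖ ≤ cd j) →
      ‖(kalman S m₀ B k).1‖ ≤ A ∧ ‖(kalman S m₀ B k).2‖ ≤ A ∧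
      ∀ (N : ℕ) (x : ℕ → Fin N → V), 1 ≤ N →
        (∀ j, ensMean (x (j + 1)) =
          analysisMean (S.H (j + 1)) (S.R (j + 1)) (S.d (j + 1))
            (ensMean fun i => S.M (j + 1) (x j i) + S.b (j + 1))
            (ensCov fun i => S.M (j + 1) (x j i) + S.b (j + 1))) →
        (∀ j, ensCov (x (j + 1)) =
          analysisCov (S.H (j + 1)) (S.R (j + 1))
            (ensCov fun i => S.M (j + 1) (x j i) + S.b (j + 1))) →
        ‖ensMean (x k) - (kalman S m₀ B k).1‖ + ‖ensCov (x k) - (kalman S m₀ B k).2‖ ≤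
          c * ((‖ensMean (x 0) - m₀‖ + ‖ensCov (x 0) - B‖) +
            (‖ensMean (x 0) - m₀‖ + ‖ensCov (x 0) - B‖) ^ 2 ^ k) := by
  induction k with
  | zero =>
    refine ⟨a, 1, zero_le_one, fun V _ _ _ W _ _ _ S m₀ B hB hm hBa _ => ⟨hm, hBa, ?_⟩⟩
    intro N x hN _ _
    have : 0 ≤ ‖ensMean (x 0) - m₀‖ + ‖ensCov (x 0) - B‖ := by positivity
    simp only [kalman, pow_zero, pow_one]
    linarith
  | succ k ih =>
    obtain ⟨A, c, hc, ih⟩ := ih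
    obtain ⟨L, hL, hLM, hLb, hLH, hLR, hLd, hLA⟩ : ∃ L : ℝ, 1 ≤ L ∧ cM (k + 1) ≤ L ∧
        cb (k + 1) ≤ L ∧ cH (k + 1) ≤ L ∧ cR (k + 1) ≤ L ∧ cd (k + 1) ≤ L ∧ A ≤ L := by
      refine ⟨1 + |cM (k + 1)| + |cb (k + 1)| + |cH (k + 1)| + |cR (k + 1)| + |cd (k + 1)| + |A|,
        ?_, ?_, ?_, ?_, ?_, ?_, ?_⟩ <;>
      linarith [abs_nonneg (cM (k + 1)), abs_nonneg (cb (k + 1)), abs_nonneg (cH (k + 1)),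
        abs_nonneg (cR (k + 1)), abs_nonneg (cd (k + 1)), abs_nonneg A, le_abs_self (cM (k + 1)),
        le_abs_self (cb (k + 1)), le_abs_self (cH (k + 1)), le_abs_self (cR (k + 1)),
        le_abs_self (cd (k + 1)), le_abs_self A]
    set D := 16 * (2 * L ^ 3) ^ 8 * L ^ 4 with hD
    have hD0 : 0 ≤ D := by positivity
    refine ⟨max (2 * L ^ 3 + (2 * L ^ 3) ^ 3 * (2 * L ^ 3 + 2 * L ^ 3 * (2 * L ^ 3)))
      (2 * L ^ 3 + (2 * L ^ 3) ^ 5), D * (2 * c + 4 * c ^ 2), by positivity,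
      fun V _ _ _ W _ _ _ S m₀ B hB hm hBa hS => ?_⟩
    obtain ⟨ih1, ih2, ih3⟩ := ih V W S m₀ B hB hm hBa fun j h1 h2 => hS j h1 (by omega)
    obtain ⟨sM, sb, sH, sR, sd⟩ := hS (k + 1) (by omega) le_rfl
    have hpos := isPositive_kalman S m₀ hB k
    have key (x : V) (Q : V →L[ℝ] V) (hQ : Q.IsPositive) :=
      norm_step_sub_le (S.R_pos (k + 1) (by omega)) (x := x) hQ hpos hL (sM.trans hLM)
        (sb.trans hLb) (sH.trans hLH) (sR.trans hLR) (sd.trans hLd) (ih1.trans hLA) (ih2.trans hLA)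
    -- The two bounds on the Kalman pair do not involve `(x, Q)`, so a dummy pair will do.
    refine ⟨(key 0 0 ContinuousLinearMap.isPositive_zero).1.trans (le_max_left _ _),
      (key 0 0 ContinuousLinearMap.isPositive_zero).2.1.trans (le_max_right _ _), ?_⟩
    intro N x hN hmean hcov
    have h1 := ih3 N x hN hmean hcov
    have h2 := (key (ensMean (x k)) (ensCov (x k)) (isPositive_ensCov _)).2.2
    rw [hmean k, hcov k, ensMean_affine hN, ensCov_affine hN]
    refine h2.trans ?_
    rw [← hD, mul_assoc D]
    refine mul_le_mul_of_nonneg_left ?_ hD0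
    set e := ‖ensMean (x k) - (kalman S m₀ B k).1‖ + ‖ensCov (x k) - (kalman S m₀ B k).2‖
    set g := ‖ensMean (x 0) - m₀‖ + ‖ensCov (x 0) - B‖
    have he0 : 0 ≤ e := by positivity
    have hg0 : 0 ≤ g := by positivity
    have p1 : 1 ≤ 2 ^ k := Nat.one_le_two_pow
    have p2 : 2 ^ (k + 1) = 2 ^ k * 2 := pow_succ 2 k
    -- Intermediate powers of `g` are absorbed into the extreme exponents `1` and `2 ^ (k + 1)`.
    have g1 : g ^ 2 ^ k ≤ g + g ^ 2 ^ (k + 1) := pow_le_add_pow hg0 p1 (by omega)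
    have g2 : g ^ 2 ≤ g + g ^ 2 ^ (k + 1) := pow_le_add_pow hg0 (by norm_num) (by omega)
    have g3 : g ^ 2 ^ (k + 1) = (g ^ 2 ^ k) ^ 2 := by rw [p2, pow_mul]
    have g4 : (g + g ^ 2 ^ k) ^ 2 ≤ 4 * (g + g ^ 2 ^ (k + 1)) := by
      nlinarith [sq_nonneg (g - g ^ 2 ^ k)]
    calc e + e ^ 2 ≤ c * (g + g ^ 2 ^ k) + (c * (g + g ^ 2 ^ k)) ^ 2 := by gcongr
      _ = c * (g + g ^ 2 ^ k) + c ^ 2 * (g + g ^ 2 ^ k) ^ 2 := by ring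
      _ ≤ c * (2 * (g + g ^ 2 ^ (k + 1))) + c ^ 2 * (4 * (g + g ^ 2 ^ (k + 1))) := by
          gcongr
          have := pow_nonneg hg0 (2 ^ (k + 1))
          linarith
      _ = _ := by ring

end Stability

/-! ### Calculus of quantities of size `1 / √N` in every moment -/

section MomentRate

/-- The even moments of `h` decay like those of a quantity of size `1 / √N`:
`E h ^ (2 n) ≤ D n / N ^ n`. -/
structure MomentRate {Ω : Type*} [MeasurableSpace Ω] (P : Measure Ω) (N : ℕ) (D : ℕ → ℝ)
    (h : Ω → ℝ) : Prop where
  aestronglyMeasurable : AEStronglyMeasurable h P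
  nonneg : ∀ ω, 0 ≤ h ω
  integrable : ∀ n, 1 ≤ n → Integrable (fun ω => h ω ^ (2 * n)) P
  integral_le : ∀ n, 1 ≤ n → ∫ ω, h ω ^ (2 * n) ∂P ≤ D n / (N : ℝ) ^ n

variable {Ω : Type*} [MeasurableSpace Ω] {P : Measure Ω} {N : ℕ} {D D' : ℕ → ℝ} {h h' : Ω → ℝ}

theorem add_pow_le_two_pow_mul {a b : ℝ} (ha : 0 ≤ a) (hb : 0 ≤ b) (m : ℕ) :
    (a + b) ^ m ≤ 2 ^ m * (a ^ m + b ^ m) := by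
  rcases le_total a b with hab | hab
  · calc (a + b) ^ m ≤ (2 * b) ^ m := by gcongr; linarith
      _ = 2 ^ m * b ^ m := mul_pow _ _ _
      _ ≤ _ := by gcongr; exact le_add_of_nonneg_left (by positivity)
  · calc (a + b) ^ m ≤ (2 * a) ^ m := by gcongr; linarith
      _ = 2 ^ m * a ^ m := mul_pow _ _ _
      _ ≤ _ := by gcongr; exact le_add_of_nonneg_right (by positivity)

theorem MomentRate.add (H : MomentRate P N D h) (H' : MomentRate P N D' h') :
    MomentRate P N (fun n => 2 ^ (2 * n) * (D n + D' n)) (fun ω => h ω + h' ω) := by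
  have hint (n : ℕ) (hn : 1 ≤ n) :
      Integrable (fun ω => 2 ^ (2 * n) * (h ω ^ (2 * n) + h' ω ^ (2 * n))) P :=
    ((H.integrable n hn).add (H'.integrable n hn)).const_mul _
  have hle (n : ℕ) (ω : Ω) : (h ω + h' ω) ^ (2 * n) ≤
      2 ^ (2 * n) * (h ω ^ (2 * n) + h' ω ^ (2 * n)) :=
    add_pow_le_two_pow_mul (H.nonneg ω) (H'.nonneg ω) _
  have hint' (n : ℕ) (hn : 1 ≤ n) : Integrable (fun ω => (h ω + h' ω) ^ (2 * n)) P := by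
    refine (hint n hn).mono' ((H.1.add H'.1).pow _) (ae_of_all _ fun ω => ?_)
    rw [Real.norm_eq_abs, abs_of_nonneg (pow_nonneg (add_nonneg (H.nonneg ω) (H'.nonneg ω)) _)]
    exact hle n ω
  refine ⟨H.1.add H'.1, fun ω => add_nonneg (H.nonneg ω) (H'.nonneg ω), hint', fun n hn => ?_⟩
  refine (integral_mono (hint' n hn) (hint n hn) (hle n)).trans ?_
  rw [integral_const_mul, integral_add (H.integrable n hn) (H'.integrable n hn), mul_div_assoc,
    add_div]
  gcongr
  · exact H.integral_le n hn
  · exact H'.integral_le n hn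

theorem MomentRate.const_mul (H : MomentRate P N D h) {c : ℝ} (hc : 0 ≤ c) :
    MomentRate P N (fun n => c ^ (2 * n) * D n) (fun ω => c * h ω) where
  aestronglyMeasurable := H.1.const_mul c
  nonneg ω := mul_nonneg hc (H.nonneg ω)
  integrable n hn := by simpa only [mul_pow] using (H.integrable n hn).const_mul (c ^ (2 * n))
  integral_le n hn := by
    simp only [mul_pow]
    rw [integral_const_mul, mul_div_assoc]
    gcongr
    exact H.integral_le n hn

/-- The moments of a power decay even faster, like `N ^ (-m n)`; since `1 ≤ N` the surplus is
discarded. -/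
theorem MomentRate.pow (H : MomentRate P N D h) (hN : 1 ≤ N) {m : ℕ} (hm : 1 ≤ m) :
    MomentRate P N (fun n => D (m * n)) (fun ω => h ω ^ m) where
  aestronglyMeasurable := H.1.pow m
  nonneg ω := pow_nonneg (H.nonneg ω) m
  integrable n hn := by
    have := H.integrable (m * n) (Nat.mul_pos hm hn)
    simpa only [← pow_mul, mul_left_comm m 2 n] using this
  integral_le n hn := by
    have hmn : 1 ≤ m * n := Nat.mul_pos hm hn
    have h1 := H.integral_le (m * n) hmn
    simp only [← pow_mul, mul_left_comm m 2 n]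
    have hNp : (0 : ℝ) < N := by positivity
    have h0 : 0 ≤ D (m * n) := by
      have : 0 ≤ D (m * n) / (N : ℝ) ^ (m * n) :=
        (integral_nonneg fun ω => pow_nonneg (H.nonneg ω) _).trans h1
      rwa [le_div_iff₀ (by positivity), zero_mul] at this
    refine h1.trans ?_
    gcongr
    · exact_mod_cast hN
    · exact Nat.le_mul_of_pos_left n hm

/-- On a probability space the `L^p` norm is at most the `L^{2n}` norm, and the `2n`-th root of `D n
/ N ^ n` is `D n ^ (1 / 2n) / √N`. -/
theorem MomentRate.eLpNorm_le [IsProbabilityMeasure P] {F : Type*} [NormedAddCommGroup F]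
    (H : MomentRate P N D h) {f : Ω → F} (hf : AEStronglyMeasurable f P)
    (hfh : ∀ᵐ ω ∂P, ‖f ω‖ ≤ h ω) {p : ℝ} {n : ℕ} (hn : 1 ≤ n)
    (hpn : p ≤ 2 * n) :
    MemLp f (ENNReal.ofReal p) P ∧
      eLpNorm f (ENNReal.ofReal p) P ≤
        ENNReal.ofReal (D n ^ ((2 * n : ℝ)⁻¹) / √(N : ℝ)) := by
  have hq0 : ((2 * n : ℕ) : ENNReal) ≠ 0 := by
    simp only [ne_eq, Nat.cast_eq_zero]; omega
  have hqt : ((2 * n : ℕ) : ENNReal) ≠ ⊤ := ENNReal.natCast_ne_top _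
  have hmem : MemLp h ((2 * n : ℕ) : ENNReal) P := by
    rw [← integrable_norm_rpow_iff H.1 hq0 hqt]
    refine (H.integrable n hn).congr (ae_of_all _ fun ω => ?_)
    simp only [ENNReal.toReal_natCast, Real.rpow_natCast, Real.norm_eq_abs,
      abs_of_nonneg (H.nonneg ω)]
  have hpq : ENNReal.ofReal p ≤ ((2 * n : ℕ) : ENNReal) := by
    rw [← ENNReal.ofReal_natCast]
    exact ENNReal.ofReal_le_ofReal (by push_cast; exact hpn)
  have hfm : MemLp f ((2 * n : ℕ) : ENNReal) P :=
    hmem.of_le hf (hfh.mono fun ω hω => hω.trans (le_abs_self _))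
  refine ⟨hfm.mono_exponent hpq, ?_⟩
  refine (eLpNorm_le_eLpNorm_of_exponent_le hpq hf).trans
    ((eLpNorm_mono_ae_real hfh).trans ?_)
  rw [hmem.eLpNorm_eq_integral_rpow_norm hq0 hqt]
  refine ENNReal.ofReal_le_ofReal ?_
  have h1 := H.integral_le n hn
  have h2 : 0 ≤ ∫ ω, h ω ^ (2 * n) ∂P := integral_nonneg fun ω => pow_nonneg (H.nonneg ω) _
  simp only [ENNReal.toReal_natCast, Real.rpow_natCast, Real.norm_eq_abs,
    abs_of_nonneg (H.nonneg _)]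
  push_cast
  refine (Real.rpow_le_rpow h2 h1 (by positivity)).trans ?_
  rcases Nat.eq_zero_or_pos N with rfl | hN
  · have : (n : ℝ) ≠ 0 := by positivity
    rw [Nat.cast_zero, zero_pow (by omega), div_zero, Real.zero_rpow (by positivity)]
    simp
  · have h0 : 0 ≤ D n := by
      have := h2.trans h1
      rwa [le_div_iff₀ (by positivity), zero_mul] at this
    rw [Real.div_rpow h0 (by positivity), Real.sqrt_eq_rpow, ← Real.rpow_natCast,
      ← Real.rpow_mul (by positivity)]
    have : (n : ℝ) * (2 * n : ℝ)⁻¹ = 1 / 2 := by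
      have : (n : ℝ) ≠ 0 := by positivity
      field_simp
    rw [this]

end MomentRate

/-! ### Sample means of i.i.d. variables and centring -/

section SampleMean

theorem memLp_natCast_iff {Ω G : Type*} [MeasurableSpace Ω] {μ : Measure Ω} [NormedAddCommGroup G]
    {f : Ω → G} (hf : AEStronglyMeasurable f μ) {q : ℕ} (hq : q ≠ 0) :
    MemLp f q μ ↔ Integrable (fun x => ‖f x‖ ^ q) μ := by
  rw [← integrable_norm_rpow_iff hf (by exact_mod_cast hq) (ENNReal.natCast_ne_top _)]
  simp only [ENNReal.toReal_natCast, Real.rpow_natCast]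

theorem map_pi_eq {Ω E : Type*} [MeasurableSpace Ω] [MeasurableSpace E] {P : Measure Ω}
    [IsProbabilityMeasure P] {μ : Measure E} {N : ℕ} {X : Fin N → Ω → E} (hX : iIndepFun X P)
    (hlaw : ∀ i, HasLaw (X i) μ P) :
    P.map (fun ω i => X i ω) = Measure.pi fun _ => μ := by
  rw [(iIndepFun_iff_map_fun_eq_pi_map fun i => (hlaw i).aemeasurable).1 hX]
  simp only [(hlaw _).map_eq]

/-- Independence makes the joint law a product measure, where `integral_norm_sum_pow_le` applies;
division by `N ^ (2n)` turns `N ^ n` into `N ^ (-n)`. -/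
theorem momentRate_sampleMean {Ω E G : Type*} [MeasurableSpace Ω] [MeasurableSpace E]
    [NormedAddCommGroup G] [InnerProductSpace ℝ G] [CompleteSpace G] {P : Measure Ω}
    [IsProbabilityMeasure P] {μ : Measure E} [IsProbabilityMeasure μ] {N : ℕ} (hN : 1 ≤ N)
    {X : Fin N → Ω → E} (hX : iIndepFun X P) (hlaw : ∀ i, HasLaw (X i) μ P)
    {y : E → G} (hy : ∀ q : ℕ, MemLp y q μ) (hy0 : ∫ x, y x ∂μ = 0) {K : ℕ → ℝ}
    (hK : ∀ j, 1 ≤ j → ∫ x, ‖y x‖ ^ (2 * j) ∂μ ≤ K j) :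
    MomentRate P N (sumMomentConst K) (fun ω => ‖(N : ℝ)⁻¹ • ∑ i, y (X i ω)‖) := by
  have hlawX := map_pi_eq hX hlaw
  have hXm : AEMeasurable (fun ω i => X i ω) P :=
    aemeasurable_pi_lambda _ fun i => (hlaw i).aemeasurable
  have hm (q : ℕ) : MemLp (fun x : Fin N → E => ‖(N : ℝ)⁻¹ • ∑ i, y (x i)‖) q
      (P.map fun ω i => X i ω) := by
    rw [hlawX]; exact ((memLp_pi_sum (hy q) N).const_smul ((N : ℝ)⁻¹)).norm
  have hNp : (0 : ℝ) < N := by positivity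
  refine ⟨(hm 0).1.comp_aemeasurable hXm, fun ω => norm_nonneg _, fun n _ => ?_, fun n _ => ?_⟩
  · have := ((hm (2 * n)).integrable_norm_pow').comp_aemeasurable hXm
    simpa only [norm_norm, Function.comp_def] using this
  · have h1 : ∫ ω, ‖(N : ℝ)⁻¹ • ∑ i, y (X i ω)‖ ^ (2 * n) ∂P =
        ∫ x, ‖(N : ℝ)⁻¹ • ∑ i, y (x i)‖ ^ (2 * n) ∂(Measure.pi fun _ : Fin N => μ) := by
      rw [← hlawX]
      exact (integral_map hXm ((hm 0).1.pow _)).symm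
    have h2 := (integral_norm_sum_pow_le μ hy hy0 hK n).2 N
    rw [h1]
    simp only [norm_smul, mul_pow, integral_const_mul]
    rw [norm_inv, Real.norm_natCast, inv_pow, inv_mul_le_iff₀ (by positivity)]
    refine h2.trans (le_of_eq ?_)
    field_simp
    ring

/-- Bounds for the even moments of `f - E f` in terms of bounds `K` for those of `f`. -/
def centredMomentConst (K : ℕ → ℝ) (j : ℕ) : ℝ := 2 ^ (2 * j) * (K j + (1 + K 1) ^ (2 * j))

variable {E G : Type*} [MeasurableSpace E] [NormedAddCommGroup G] [InnerProductSpace ℝ G]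
  {μ : Measure E} [IsProbabilityMeasure μ] {f : E → G} {K : ℕ → ℝ}

theorem norm_integral_le_one_add (hf : ∀ q : ℕ, MemLp f q μ)
    (hK : ∀ j, 1 ≤ j → ∫ x, ‖f x‖ ^ (2 * j) ∂μ ≤ K j) : ‖∫ x, f x ∂μ‖ ≤ 1 + K 1 := by
  have hi1 : Integrable (fun x => ‖f x‖) μ := by simpa using (hf 1).integrable_norm_pow'
  have hi2 : Integrable (fun x => ‖f x‖ ^ (2 * 1)) μ := (hf _).integrable_norm_pow'
  refine (norm_integral_le_integral_norm f).trans ?_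
  calc ∫ x, ‖f x‖ ∂μ ≤ ∫ x, (1 + ‖f x‖ ^ (2 * 1)) ∂μ :=
        integral_mono hi1 ((integrable_const 1).add hi2) fun x => by
          simp only [mul_one]; nlinarith [sq_nonneg (‖f x‖ - 1)]
    _ = 1 + ∫ x, ‖f x‖ ^ (2 * 1) ∂μ := by rw [integral_add (integrable_const 1) hi2]; simp
    _ ≤ _ := by gcongr; exact hK 1 le_rfl

theorem memLp_sub_integral (hf : ∀ q : ℕ, MemLp f q μ) (q : ℕ) :
    MemLp (fun x => f x - ∫ x, f x ∂μ) q μ :=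
  (hf q).sub (memLp_const _)

theorem integral_norm_sub_integral_pow_le (hf : ∀ q : ℕ, MemLp f q μ)
    (hK : ∀ j, 1 ≤ j → ∫ x, ‖f x‖ ^ (2 * j) ∂μ ≤ K j) (j : ℕ) (hj : 1 ≤ j) :
    ∫ x, ‖f x - ∫ x, f x ∂μ‖ ^ (2 * j) ∂μ ≤ centredMomentConst K j := by
  have hm := norm_integral_le_one_add hf hK
  have hi : Integrable (fun x => ‖f x‖ ^ (2 * j)) μ := (hf _).integrable_norm_pow'
  calc ∫ x, ‖f x - ∫ x, f x ∂μ‖ ^ (2 * j) ∂μ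
      ≤ ∫ x, 2 ^ (2 * j) * (‖f x‖ ^ (2 * j) + (1 + K 1) ^ (2 * j)) ∂μ := by
        refine integral_mono (memLp_sub_integral hf _).integrable_norm_pow'
          ((hi.add (integrable_const _)).const_mul _) fun x => ?_
        have h0 : 0 ≤ 1 + K 1 := (norm_nonneg _).trans hm
        refine le_trans ?_ (add_pow_le_two_pow_mul (norm_nonneg (f x)) h0 _)
        gcongr
        exact (norm_sub_le _ _).trans (by gcongr)
    _ = 2 ^ (2 * j) * (∫ x, ‖f x‖ ^ (2 * j) ∂μ + (1 + K 1) ^ (2 * j)) := by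
        rw [integral_const_mul, integral_add hi (integrable_const _)]; simp
    _ ≤ _ := by
        rw [centredMomentConst]; gcongr; exact hK j hj

theorem integral_sub_integral [CompleteSpace G] (hf : ∀ q : ℕ, MemLp f q μ) :
    ∫ x, (f x - ∫ x, f x ∂μ) ∂μ = 0 := by
  rw [integral_sub (memLp_one_iff_integrable.1 (by simpa using hf 1)) (integrable_const _)]
  simp

end SampleMean

/-! ### Rank one operators as vectors of a Hilbert space -/

section Tensor

open scoped TensorProduct

variable {V : Type*} [NormedAddCommGroup V] [InnerProductSpace ℝ V]

/-- `x ⊗ x` in the Hilbert space tensor product of `V` with itself, whose norm dominates the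
operator norm. -/
noncomputable def tensorSq (x : V) : UniformSpace.Completion (V ⊗[ℝ] V) :=
  ((x ⊗ₜ[ℝ] x : V ⊗[ℝ] V) : UniformSpace.Completion (V ⊗[ℝ] V))

theorem continuous_tensorSq : Continuous (tensorSq : V → _) :=
  (UniformSpace.Completion.continuous_coe _).comp
    ((TensorProduct.mkL ℝ V V).continuous₂.comp (continuous_id.prodMk continuous_id))

theorem norm_tensorSq (x : V) : ‖tensorSq x‖ = ‖x‖ ^ 2 := by
  rw [tensorSq, UniformSpace.Completion.norm_coe, TensorProduct.norm_tmul, sq]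

theorem inner_tensorSq (x u v : V) :
    inner ℝ (tensorSq x) ((v ⊗ₜ[ℝ] u : V ⊗[ℝ] V) : UniformSpace.Completion (V ⊗[ℝ] V)) =
      inner ℝ (InnerProductSpace.rankOne ℝ x x u) v := by
  rw [tensorSq, UniformSpace.Completion.inner_coe, TensorProduct.inner_tmul,
    InnerProductSpace.rankOne_apply, real_inner_smul_left, mul_comm]

/-- Operator norm below Hilbert–Schmidt norm: Cauchy–Schwarz with the test tensor `T u ⊗ u`. Only
matching pairings with simple tensors are needed, not an isometry between tensors and operators. -/
theorem opNorm_le_norm_of_inner_eq {T : V →L[ℝ] V} {t : UniformSpace.Completion (V ⊗[ℝ] V)}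
    (h : ∀ u v, inner ℝ t ((v ⊗ₜ[ℝ] u : V ⊗[ℝ] V) : UniformSpace.Completion (V ⊗[ℝ] V)) =
      inner ℝ (T u) v) : ‖T‖ ≤ ‖t‖ := by
  refine ContinuousLinearMap.opNorm_le_bound _ (norm_nonneg _) fun u => ?_
  have h1 : ‖T u‖ ^ 2 ≤ ‖t‖ * (‖T u‖ * ‖u‖) := by
    have h2 := real_inner_le_norm t
      ((T u ⊗ₜ[ℝ] u : V ⊗[ℝ] V) : UniformSpace.Completion (V ⊗[ℝ] V))
    rwa [h, real_inner_self_eq_norm_sq, UniformSpace.Completion.norm_coe,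
      TensorProduct.norm_tmul] at h2
  rcases (norm_nonneg (T u)).eq_or_lt with h0 | h0
  · rw [← h0]; positivity
  · nlinarith

theorem continuous_rankOne_self : Continuous fun x : V => InnerProductSpace.rankOne ℝ x x :=
  (InnerProductSpace.rankOne ℝ : V →L[ℝ] V →L⋆[ℝ] V →L[ℝ] V).continuous.clm_apply continuous_id

end Tensor

/-! ### Error of the initial sample mean and sample covariance -/

section InitialEnsemble

variable {V : Type*} [NormedAddCommGroup V] [InnerProductSpace ℝ V] [MeasurableSpace V]
  {μ : Measure V} [IsProbabilityMeasure μ] {K : ℕ → ℝ}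

theorem norm_distCov_le (hμ : ∀ q : ℕ, MemLp (fun x : V => x) q μ)
    (hK : ∀ j, 1 ≤ j → ∫ x : V, ‖x‖ ^ (2 * j) ∂μ ≤ K j) :
    ‖distCov μ‖ ≤ centredMomentConst K 1 := by
  refine (norm_integral_le_integral_norm _).trans
    (le_trans (le_of_eq ?_) (integral_norm_sub_integral_pow_le hμ hK 1 le_rfl))
  simp only [InnerProductSpace.norm_rankOne, mul_one, sq]
  rfl

theorem integrable_rankOne_self (hμ : ∀ q : ℕ, MemLp (fun x : V => x) q μ) :
    Integrable (fun x => InnerProductSpace.rankOne ℝ (x - distMean μ) (x - distMean μ)) μ := by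
  have hi : Integrable (fun x => ‖x - distMean μ‖ ^ 2) μ :=
    (memLp_sub_integral hμ 2).integrable_norm_pow'
  refine hi.mono' (continuous_rankOne_self.comp_aestronglyMeasurable (memLp_sub_integral hμ 1).1)
    (ae_of_all _ fun x => ?_)
  rw [InnerProductSpace.norm_rankOne, sq]

variable [CompleteSpace V]

theorem inner_distCov (hμ : ∀ q : ℕ, MemLp (fun x : V => x) q μ) (u v : V) :
    inner ℝ (distCov μ u) v = ∫ x, inner ℝ
      (InnerProductSpace.rankOne ℝ (x - distMean μ) (x - distMean μ) u) v ∂μ := by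
  have hi := integrable_rankOne_self hμ
  rw [distCov, ContinuousLinearMap.integral_apply hi, real_inner_comm,
    ← integral_inner (hi.apply_continuousLinearMap u)]
  simp only [real_inner_comm]

theorem isPositive_distCov (hμ : ∀ q : ℕ, MemLp (fun x : V => x) q μ) :
    (distCov μ).IsPositive := by
  refine ContinuousLinearMap.isPositive_def.2 ⟨fun u v => ?_, fun u => ?_⟩
  · change inner ℝ (distCov μ u) v = inner ℝ u (distCov μ v)
    rw [real_inner_comm _ u, inner_distCov hμ, inner_distCov hμ]
    simp only [InnerProductSpace.rankOne_apply, real_inner_smul_left, mul_comm]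
  · rw [ContinuousLinearMap.reApplyInnerSelf_apply, inner_distCov hμ]
    simp only [RCLike.re_to_real]
    refine integral_nonneg fun x => ?_
    simp only [InnerProductSpace.rankOne_apply, real_inner_smul_left]
    exact mul_self_nonneg _

/-- Bounds for the moments of the error of the mean and covariance of an i.i.d. ensemble, in terms
of bounds `K` for the even moments of the distribution. -/
noncomputable def initialMomentConst (K : ℕ → ℝ) (n : ℕ) : ℝ :=
  2 ^ (2 * n) * (sumMomentConst (centredMomentConst K) n
    + 2 ^ (2 * n) * (sumMomentConst (centredMomentConst fun j => centredMomentConst K (2 * j)) n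
      + sumMomentConst (centredMomentConst K) (2 * n)))

/-- With deviations taken from the true mean, the covariance error is a centred sample mean of
tensor squares minus the rank one operator of the mean error. The majorant `h` is therefore the norm
of the mean error, plus the norm of the tensor sample mean, plus the square of the first. -/
theorem exists_momentRate_initial (hμ : ∀ q : ℕ, MemLp (fun x : V => x) q μ)
    (hK : ∀ j, 1 ≤ j → ∫ x : V, ‖x‖ ^ (2 * j) ∂μ ≤ K j)
    {Ω : Type*} [MeasurableSpace Ω] {P : Measure Ω} [IsProbabilityMeasure P] {N : ℕ} (hN : 1 ≤ N)
    {X : Fin N → Ω → V} (hX : iIndepFun X P) (hlaw : ∀ i, HasLaw (X i) μ P) :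
    ∃ h : Ω → ℝ, MomentRate P N (initialMomentConst K) h ∧
      ∀ ω, ‖ensMean (fun i => X i ω) - distMean μ‖ + ‖ensCov (fun i => X i ω) - distCov μ‖
        ≤ h ω := by
  set f : V → UniformSpace.Completion (TensorProduct ℝ V V) := fun x => tensorSq (x - distMean μ)
    with hf
  have hfn (x : V) : ‖f x‖ = ‖x - distMean μ‖ ^ 2 := norm_tensorSq _
  have hξ := memLp_sub_integral hμ
  have hfm : AEStronglyMeasurable f μ :=
    continuous_tensorSq.comp_aestronglyMeasurable (hξ 1).1
  have hfL (q : ℕ) : MemLp f q μ := by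
    rcases eq_or_ne q 0 with rfl | hq
    · simpa using hfm
    · rw [memLp_natCast_iff hfm hq]
      simp only [hfn, ← pow_mul]
      exact (hξ (2 * q)).integrable_norm_pow'
  have hfK (j : ℕ) (hj : 1 ≤ j) :
      ∫ x, ‖f x‖ ^ (2 * j) ∂μ ≤ centredMomentConst K (2 * j) := by
    simp only [hfn, ← pow_mul]
    exact integral_norm_sub_integral_pow_le hμ hK (2 * j) (by omega)
  have hA := momentRate_sampleMean hN hX hlaw hξ (integral_sub_integral hμ)
    (integral_norm_sub_integral_pow_le hμ hK)
  have hB := momentRate_sampleMean hN hX hlaw (memLp_sub_integral hfL) (integral_sub_integral hfL)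
    (integral_norm_sub_integral_pow_le hfL hfK)
  refine ⟨_, hA.add (hB.add (hA.pow hN one_le_two)), fun ω => ?_⟩
  have hmean := ensMean_sub hN (fun i => X i ω) (distMean μ)
  have hmean' : (N : ℝ)⁻¹ • ∑ i, (X i ω - ∫ x, x ∂μ) = ensMean (fun i => X i ω) - distMean μ :=
    hmean
  rw [hmean']
  refine add_le_add le_rfl ?_
  rw [ensCov_eq_sub hN _ (distMean μ), sub_right_comm]
  refine (norm_sub_le _ _).trans (add_le_add ?_ ?_)
  · refine opNorm_le_norm_of_inner_eq fun u v => ?_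
    have hint : Integrable f μ := memLp_one_iff_integrable.1 (by simpa using hfL 1)
    have hI : inner ℝ (∫ x, f x ∂μ)
        ((v ⊗ₜ[ℝ] u : TensorProduct ℝ V V) : UniformSpace.Completion (TensorProduct ℝ V V)) =
        inner ℝ (distCov μ u) v := by
      rw [inner_distCov hμ, real_inner_comm, ← integral_inner hint]
      refine integral_congr_ae (ae_of_all _ fun x => ?_)
      simp only [real_inner_comm, hf, inner_tensorSq]
    have h0 : (N : ℝ) ≠ 0 := by positivity
    have hfi (x : V) := inner_tensorSq (x - distMean μ) u v
    simp only [sub_apply, smul_apply, sum_apply, inner_sub_left, real_inner_smul_left,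
      sum_inner, hI, hfi, f]
    rw [Finset.sum_sub_distrib, Finset.sum_const, Finset.card_univ, Fintype.card_fin, nsmul_eq_mul]
    field_simp
  · rw [InnerProductSpace.norm_rankOne, sq]

end InitialEnsemble

/-! ### Passage to random ensembles and to the limit -/

section Convergence

theorem memLp_id_of_integrable_rpow {V : Type*} [NormedAddCommGroup V]
    [TopologicalSpace.SeparableSpace V] [MeasurableSpace V] [BorelSpace V] {μ : Measure V}
    [IsProbabilityMeasure μ] (hμ : ∀ q : ℝ, 1 ≤ q → Integrable (fun x : V => ‖x‖ ^ q) μ) (q : ℕ) :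
    MemLp (fun x : V => x) q μ := by
  have : SecondCountableTopology V := UniformSpace.secondCountable_of_separable V
  have hm : AEStronglyMeasurable (fun x : V => x) μ := aestronglyMeasurable_id
  rcases eq_or_ne q 0 with rfl | hq
  · simpa using hm
  · rw [memLp_natCast_iff hm hq]
    simpa only [Real.rpow_natCast] using hμ q (by exact_mod_cast Nat.one_le_iff_ne_zero.2 hq)

theorem aestronglyMeasurable_ensMean {V Ω : Type*} [NormedAddCommGroup V] [InnerProductSpace ℝ V]
    [MeasurableSpace Ω] {P : Measure Ω} {N : ℕ} {X : Fin N → Ω → V}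
    (hX : ∀ i, AEStronglyMeasurable (X i) P) :
    AEStronglyMeasurable (fun ω => ensMean fun i => X i ω) P :=
  (Finset.aestronglyMeasurable_fun_sum _ fun i _ => hX i).const_smul _

theorem aestronglyMeasurable_ensCov {V Ω : Type*} [NormedAddCommGroup V] [InnerProductSpace ℝ V]
    [MeasurableSpace Ω] {P : Measure Ω} {N : ℕ} {X : Fin N → Ω → V}
    (hX : ∀ i, AEStronglyMeasurable (X i) P) :
    AEStronglyMeasurable (fun ω => ensCov fun i => X i ω) P := by
  have h (i : Fin N) := continuous_rankOne_self.comp_aestronglyMeasurable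
    ((hX i).sub (aestronglyMeasurable_ensMean hX))
  exact (Finset.aestronglyMeasurable_fun_sum Finset.univ fun i _ => h i).const_smul (N : ℝ)⁻¹

theorem tendsto_ofReal_div_sqrt (C : ℝ) :
    Tendsto (fun N : ℕ => ENNReal.ofReal (C / √(N : ℝ))) atTop (𝓝 0) := by
  rw [← ENNReal.ofReal_zero]
  exact ENNReal.tendsto_ofReal (tendsto_const_nhds.div_atTop
    (Real.tendsto_sqrt_atTop.comp tendsto_natCast_atTop_atTop))

end Convergence

/-- The error bound for one run of a filter, from a bound for the growth of the initial error along
every path. -/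
theorem IsUnbiasedSqrtFilter.eLpNorm_error_le {V W Ω : Type*}
    [NormedAddCommGroup V] [InnerProductSpace ℝ V] [CompleteSpace V]
    [TopologicalSpace.SeparableSpace V] [MeasurableSpace V] [BorelSpace V]
    [NormedAddCommGroup W] [InnerProductSpace ℝ W] [CompleteSpace W] [MeasurableSpace Ω]
    {S : Problem V W} {μ₀ : Measure V} [IsProbabilityMeasure μ₀] {P : Measure Ω}
    [IsProbabilityMeasure P] {N : ℕ} {X : ℕ → Fin N → Ω → V} (hX : IsUnbiasedSqrtFilter S μ₀ P X)
    (hN : 1 ≤ N) (hμ : ∀ q : ℕ, MemLp (fun x : V => x) q μ₀) {K : ℕ → ℝ}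
    (hK : ∀ j, 1 ≤ j → ∫ x : V, ‖x‖ ^ (2 * j) ∂μ₀ ≤ K j) {k : ℕ} {c : ℝ} (hc : 0 ≤ c)
    {KF : V × (V →L[ℝ] V)}
    (hpath : ∀ x : ℕ → Fin N → V,
      (∀ j, ensMean (x (j + 1)) =
        analysisMean (S.H (j + 1)) (S.R (j + 1)) (S.d (j + 1))
          (ensMean fun i => S.M (j + 1) (x j i) + S.b (j + 1))
          (ensCov fun i => S.M (j + 1) (x j i) + S.b (j + 1))) →
      (∀ j, ensCov (x (j + 1)) =
        analysisCov (S.H (j + 1)) (S.R (j + 1))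
          (ensCov fun i => S.M (j + 1) (x j i) + S.b (j + 1))) →
      ‖ensMean (x k) - KF.1‖ + ‖ensCov (x k) - KF.2‖ ≤
        c * ((‖ensMean (x 0) - distMean μ₀‖ + ‖ensCov (x 0) - distCov μ₀‖) +
          (‖ensMean (x 0) - distMean μ₀‖ + ‖ensCov (x 0) - distCov μ₀‖) ^ 2 ^ k))
    {p : ℝ} {n : ℕ} (hn : 1 ≤ n) (hpn : p ≤ 2 * n) {C : ℝ}
    (hC : C = (c ^ (2 * n) * (2 ^ (2 * n) *
      (initialMomentConst K n + initialMomentConst K (2 ^ k * n)))) ^ ((2 * n : ℝ)⁻¹)) :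
    MemLp (fun ω => ensMean (fun i => X k i ω) - KF.1) (ENNReal.ofReal p) P ∧
      eLpNorm (fun ω => ensMean (fun i => X k i ω) - KF.1) (ENNReal.ofReal p) P ≤
        ENNReal.ofReal (C / √(N : ℝ)) ∧
      MemLp (fun ω => ensCov (fun i => X k i ω) - KF.2) (ENNReal.ofReal p) P ∧
      eLpNorm (fun ω => ensCov (fun i => X k i ω) - KF.2) (ENNReal.ofReal p) P ≤
        ENNReal.ofReal (C / √(N : ℝ)) := by
  subst hC
  have : SecondCountableTopology V := UniformSpace.secondCountable_of_separable V
  have hXm (i : Fin N) : AEStronglyMeasurable (X k i) P :=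
    (hX.aemeasurable k i).aestronglyMeasurable
  obtain ⟨h, hrate, hle⟩ := exists_momentRate_initial hμ hK hN hX.indep hX.law
  have hfinal := (hrate.add (hrate.pow hN (Nat.one_le_two_pow (n := k)))).const_mul (c := c) hc
  have hbound : ∀ᵐ ω ∂P, ‖ensMean (fun i => X k i ω) - KF.1‖
      + ‖ensCov (fun i => X k i ω) - KF.2‖ ≤ c * (h ω + h ω ^ 2 ^ k) := by
    -- There are countably many times, so almost every path obeys all update equations at once and
    -- the deterministic estimate applies to it.
    filter_upwards [ae_all_iff.2 hX.mean, ae_all_iff.2 hX.cov] with ω h1 h2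
    refine (hpath (fun j i => X j i ω) h1 h2).trans ?_
    gcongr <;> exact hle ω
  obtain ⟨r1, r2⟩ := hfinal.eLpNorm_le
    ((aestronglyMeasurable_ensMean hXm).sub aestronglyMeasurable_const)
    (hbound.mono fun ω hω => (le_add_of_nonneg_right (norm_nonneg _)).trans hω) hn hpn
  obtain ⟨r3, r4⟩ := hfinal.eLpNorm_le
    ((aestronglyMeasurable_ensCov hXm).sub aestronglyMeasurable_const)
    (hbound.mono fun ω hω => (le_add_of_nonneg_left (norm_nonneg _)).trans hω) hn hpn
  exact ⟨r1, r2, r3, r4⟩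

end EnsembleFilter

theorem theorem6p1 (p : ℝ) (hp : 1 ≤ p) (k : ℕ)
    -- bounds for the norms of the inputs at each time and for the moments of the initial
    -- distribution: the constant depends on these, on `p` and on `k` only
    (cM cb cH cR cd : ℕ → ℝ) (cmom : ℝ → ℝ) :
    ∃ C : ℝ,
      ∀ (V : Type*) [NormedAddCommGroup V] [InnerProductSpace ℝ V] [CompleteSpace V]
        [TopologicalSpace.SeparableSpace V] [MeasurableSpace V] [BorelSpace V]
        (W : Type*) [NormedAddCommGroup W] [InnerProductSpace ℝ W] [CompleteSpace W]
        [TopologicalSpace.SeparableSpace W]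
        (S : EnsembleFilter.Problem V W) (μ₀ : Measure V) [IsProbabilityMeasure μ₀],
        (∀ q : ℝ, 1 ≤ q → Integrable (fun x : V => ‖x‖ ^ q) μ₀) →
        (∀ q : ℝ, 1 ≤ q → ∫ x : V, ‖x‖ ^ q ∂μ₀ ≤ cmom q) →
        (∀ j : ℕ, 1 ≤ j → j ≤ k →
          ‖S.M j‖ ≤ cM j ∧ ‖S.b j‖ ≤ cb j ∧ ‖S.H j‖ ≤ cH j ∧
            ‖Ring.inverse (S.R j)‖ ≤ cR j ∧ ‖S.d j‖ ≤ cd j) →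
        -- `KF` is the pair of the Kalman filter analysis mean and covariance at time `k`
        let KF : V × (V →L[ℝ] V) :=
          EnsembleFilter.kalman S (EnsembleFilter.distMean μ₀) (EnsembleFilter.distCov μ₀) k
        -- the error estimates for every ensemble size
        (∀ (Ω : Type*) [MeasurableSpace Ω] (P : Measure Ω) [IsProbabilityMeasure P]
          (N : ℕ) (X : ℕ → Fin N → Ω → V), 1 ≤ N →
          EnsembleFilter.IsUnbiasedSqrtFilter S μ₀ P X →
            MemLp (fun ω => EnsembleFilter.ensMean (fun i => X k i ω) - KF.1)
              (ENNReal.ofReal p) P ∧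
            eLpNorm (fun ω => EnsembleFilter.ensMean (fun i => X k i ω) - KF.1)
              (ENNReal.ofReal p) P ≤ ENNReal.ofReal (C / √(N : ℝ)) ∧
            MemLp (fun ω => EnsembleFilter.ensCov (fun i => X k i ω) - KF.2)
              (ENNReal.ofReal p) P ∧
            eLpNorm (fun ω => EnsembleFilter.ensCov (fun i => X k i ω) - KF.2)
              (ENNReal.ofReal p) P ≤ ENNReal.ofReal (C / √(N : ℝ))) ∧
        -- convergence as the ensemble size grows
        (∀ (Ω : ℕ → Type*) [∀ N, MeasurableSpace (Ω N)] (P : ∀ N, Measure (Ω N))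
          [∀ N, IsProbabilityMeasure (P N)] (X : ∀ N : ℕ, ℕ → Fin N → Ω N → V),
          (∀ N : ℕ, 1 ≤ N → EnsembleFilter.IsUnbiasedSqrtFilter S μ₀ (P N) (X N)) →
            Tendsto (fun N => eLpNorm
              (fun ω => EnsembleFilter.ensMean (fun i => X N k i ω) - KF.1)
              (ENNReal.ofReal p) (P N)) atTop (𝓝 0) ∧
            Tendsto (fun N => eLpNorm
              (fun ω => EnsembleFilter.ensCov (fun i => X N k i ω) - KF.2)
              (ENNReal.ofReal p) (P N)) atTop (𝓝 0)) := by
  -- The initial bound `a` is the larger of the bounds for the norms of the mean and covariance of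
  -- `μ₀`, both computed from the moment bounds at even exponents.
  obtain ⟨A, c, hc, hstab⟩ := EnsembleFilter.exists_kalman_stability cM cb cH cR cd
    (max (1 + cmom (2 * (1 : ℕ)))
      (EnsembleFilter.centredMomentConst (fun j => cmom (2 * (j : ℝ))) 1)) k
  obtain ⟨n, hn, hpn⟩ : ∃ n : ℕ, 1 ≤ n ∧ p ≤ 2 * n :=
    -- Any even order `2n ≥ p` works, since moments of all orders are controlled.
    ⟨⌈p⌉₊, Nat.one_le_ceil_iff.2 (by linarith), by linarith [Nat.le_ceil p]⟩
  obtain ⟨C, hC⟩ : ∃ C : ℝ, C = (c ^ (2 * n) * (2 ^ (2 * n) *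
      (EnsembleFilter.initialMomentConst (fun j => cmom (2 * (j : ℝ))) n
        + EnsembleFilter.initialMomentConst (fun j => cmom (2 * (j : ℝ))) (2 ^ k * n))))
          ^ ((2 * n : ℝ)⁻¹) := ⟨_, rfl⟩
  refine ⟨C, ?_⟩
  intro V _ _ _ _ _ _ W _ _ _ _ S μ₀ _ hmom hcmom hS
  have hμ := EnsembleFilter.memLp_id_of_integrable_rpow hmom
  have hK (j : ℕ) (hj : 1 ≤ j) : ∫ x : V, ‖x‖ ^ (2 * j) ∂μ₀ ≤ cmom (2 * (j : ℝ)) := by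
    have hj' : (1 : ℝ) ≤ j := by exact_mod_cast hj
    refine le_trans (le_of_eq ?_) (hcmom (2 * (j : ℝ)) (by linarith))
    simp only [← Real.rpow_natCast, Nat.cast_mul, Nat.cast_ofNat]
  obtain ⟨-, -, hens⟩ := hstab V W S (EnsembleFilter.distMean μ₀) (EnsembleFilter.distCov μ₀)
    (EnsembleFilter.isPositive_distCov hμ)
    ((EnsembleFilter.norm_integral_le_one_add hμ hK).trans (le_max_left _ _))
    ((EnsembleFilter.norm_distCov_le hμ hK).trans (le_max_right _ _)) hS
  refine ⟨fun Ω _ P _ N X hN hX => hX.eLpNorm_error_le hN hμ hK hc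
    (fun x => hens N x hN) hn hpn hC, fun Ω _ P _ X hX => ?_⟩
  have hmain (N : ℕ) (hN : 1 ≤ N) := (hX N hN).eLpNorm_error_le hN hμ hK hc
    (fun x => hens N x hN) hn hpn hC
  have hlim := EnsembleFilter.tendsto_ofReal_div_sqrt C
  constructor
  · refine tendsto_of_tendsto_of_tendsto_of_le_of_le' tendsto_const_nhds hlim
      (Eventually.of_forall fun _ => zero_le) ?_
    filter_upwards [eventually_ge_atTop 1] with N hN using (hmain N hN).2.1
  · refine tendsto_of_tendsto_of_tendsto_of_le_of_le' tendsto_const_nhds hlim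
      (Eventually.of_forall fun _ => zero_le) ?_
    filter_upwards [eventually_ge_atTop 1] with N hN using (hmain N hN).2.2.2
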